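/- Let $M$ be a (Hausdorff, finite-dimensional, boundaryless) smooth manifold and let $\Lambda$ be a smooth 2-contravariant tensor field on $M$, not assumed to be skew-symmetric. Conventions: - $\sharp_\Lambda:T^*M\to TM$ is the vector bundle morphism $\sharp_\Lambda(\omega_x)=i_{\omega_x}\Lambda(x)$, i.e. $\langle\beta,\sharp_\Lambda(\alpha)\rangle=\langle\Lambda,\alpha\otimes\beta\rangle$. - For 1-forms $\mu,\nu$, $[\mu,\nu]_\Lambda=i_{\sharp_\Lambda(\mu)}\mathrm d\nu-i_{\sharp_\Lambda(\nu)}\mathrm d\mu+\mathrm d\langle\Lambda,\mu\otimes\nu\rangle$. The bracket of vector fields is the Lie bracket. - $\Lambda_M$ is the canonical Poisson tensor on $T^*M$, in adapted coordinates $(x^j,p_j)$ equal to $\partial_{p_j}\wedge\partial_{x^j}=\partial_{p_j}\otimes\partial_{x^j}-\partial_{x^j}\otimes\partial_{p_j}$. - $\Lambda^c$ is the complete (tangent) lift of $\Lambda$ to $TM$: if $\Lambda=\Lambda^{ij}\partial_{x^i}\otimes\partial_{x^j}$ then, in adapted coordinates $(x^j,\dot x^j)$, $\Lambda^c=\frac{\partial\Lambda^{ij}}{\partial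 x^k}\dot x^k\,\partial_{\dot x^i}\otimes\partial_{\dot x^j}+\Lambda^{ij}(\partial_{x^i}\otimes\partial_{\dot x^j}+\partial_{\dot x^i}\otimes\partial_{x^j})$. - 2-contravariant tensor fields $P$ on $N$ and $Q$ on $N'$ are $\psi$-related, for a smooth map $\psi:N\to N'$, if $(T_q\psi\otimes T_q\psi)P(q)=Q(\psi(q))$ for all $q\in N$. - $\Lambda$ is Poisson if it is skew-symmetric and the bracket $\{f,g\}=\langle\Lambda,\mathrm df\otimes\mathrm dg\rangle$ on $C^\infty(M)$ satisfies the Jacobi identity. All tensors, forms and vector bundle morphisms are smooth. The following are equivalent: 1. (i) $\Lambda$ is a Poisson tensor; 2. (ii) $\sharp_\Lambda([\mu,\nu]_\Lambda)=[\sharp_\Lambda(\mu),\sharp_\Lambda(\nu)]$ for all 1-forms $\mu,\nu$; 3. (iii) $\Lambda_M$ and $-\Lambda^c$ are $\sharp_\Lambda$-related; 4. (iv) there is a vector bundle morphism $F:T^*M\to TM$ over the identity of $M$ such that $\Lambda_M$ and $-\Lambda^c$ are $F$-related; 5. (v) there is a 2-contravariant tensor $\Lambda_1$ on $M$ such that $\Lambda_M$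 and $\Lambda_1^c$ are $\sharp_\Lambda$-related; 6. (vi) there is a vector bundle morphism $F:T^*M\to TM$ over the identity of $M$, which vanishes identically over no open set $U\subseteq M$ on which $\Lambda$ does not vanish identically (that is, $\operatorname{supp}\Lambda\subseteq\operatorname{supp}F$), such that $F([\mu,\nu]_\Lambda)=[F(\mu),F(\nu)]$ for all 1-forms $\mu,\nu$; 7. (vii) there is a 2-contravariant tensor $\Lambda_1$ on $M$ such that $\sharp_\Lambda([\mu,\nu]_{\Lambda_1})=[\sharp_\Lambda(\mu),\sharp_\Lambda(\nu)]$ for all 1-forms $\mu,\nu$. Moreover, every morphism $F$ as in (iv) or as in (vi) equals $\sharp_\Lambda$, and its existence forces $\Lambda$ to be skew-symmetric; and every tensor $\Lambda_1$ as in (v) equals $-\Lambda$, and its existence forces $\Lambda$ to be skew-symmetric. -/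

import Mathlib

set_option maxSynthPendingDepth 3

open scoped Manifold ContDiff Bundle

noncomputable section

namespace PoissonChar

/-! ### Bilinear forms on a dual space (elements of `V ⊗ V`) -/

section Linear

variable {V W : Type*}
  [AddCommGroup V] [Module ℝ V] [TopologicalSpace V] [IsTopologicalAddGroup V]
  [ContinuousSMul ℝ V]
  [AddCommGroup W] [Module ℝ W] [TopologicalSpace W] [IsTopologicalAddGroup W]
  [ContinuousSMul ℝ W]

/-- Two-contravariant tensors on a (finite-dimensional) vector space `V`: bilinear forms
on the dual of `V`, so that `P α β` is the pairing `⟨P, α ⊗ β⟩`. -/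
abbrev Tensor2 (V : Type*) [AddCommGroup V] [Module ℝ V] [TopologicalSpace V]
    [IsTopologicalAddGroup V] [ContinuousSMul ℝ V] : Type _ :=
  (V →L[ℝ] ℝ) →L[ℝ] (V →L[ℝ] ℝ) →L[ℝ] ℝ

/-- The image `(A ⊗ B) P` of `P ∈ V ⊗ V` under two linear maps `A B : V → W`. -/
def Tensor2.map (A B : V →L[ℝ] W) (P : Tensor2 V) : Tensor2 W :=
  (ContinuousLinearMap.precomp ℝ (ContinuousLinearMap.precomp ℝ B)) ∘L P ∘L
    (ContinuousLinearMap.precomp ℝ A)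

theorem Tensor2.map_apply (A B : V →L[ℝ] W) (P : Tensor2 V) (α β : W →L[ℝ] ℝ) :
    P.map A B α β = P (α ∘L A) (β ∘L B) := rfl

/-- Each continuous functional on the dual of a finite-dimensional space is evaluation at a vector. -/
theorem Tensor2.exists_vector [T2Space V] [FiniteDimensional ℝ V] (P : Tensor2 V) :
    ∃ S : (V →L[ℝ] ℝ) →ₗ[ℝ] V, ∀ α β : V →L[ℝ] ℝ, β (S α) = P α β := by
  let e : (V →ₗ[ℝ] ℝ) ≃ₗ[ℝ] (V →L[ℝ] ℝ) := LinearMap.toContinuousLinearMap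
  let Q : (V →L[ℝ] ℝ) →ₗ[ℝ] Module.Dual ℝ (Module.Dual ℝ V) :=
    { toFun := fun α => (P α).toLinearMap ∘ₗ e.toLinearMap
      map_add' := fun a b => by ext; simp
      map_smul' := fun c a => by ext; simp }
  refine ⟨(Module.evalEquiv ℝ V).symm.toLinearMap ∘ₗ Q, fun α β => ?_⟩
  have h := Module.apply_evalEquiv_symm_apply ℝ V (e.symm β) (Q α)
  have h2 : Q α (e.symm β) = P α β := by simp [Q]
  rw [← h2, ← h]
  rfl

/-- The map `♯_P : V* → V`, `♯_P α = i_α P`, of a tensor `P ∈ V ⊗ V`: the vector `♯_P α` is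
characterized by `β (♯_P α) = P α β` for all `β`, see `Tensor2.apply_sharp`. -/
def Tensor2.sharp [T2Space V] [FiniteDimensional ℝ V] (P : Tensor2 V) : (V →L[ℝ] ℝ) →L[ℝ] V :=
  haveI : FiniteDimensional ℝ (V →L[ℝ] ℝ) := Module.Finite.equiv
    (LinearMap.toContinuousLinearMap : (V →ₗ[ℝ] ℝ) ≃ₗ[ℝ] (V →L[ℝ] ℝ))
  LinearMap.toContinuousLinearMap (Classical.choose P.exists_vector)

theorem Tensor2.apply_sharp [T2Space V] [FiniteDimensional ℝ V] (P : Tensor2 V)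
    (α β : V →L[ℝ] ℝ) : β (P.sharp α) = P α β :=
  Classical.choose_spec P.exists_vector α β

end Linear

/-! ### Models in coordinates -/

section Model

variable {E : Type*} [NormedAddCommGroup E] [NormedSpace ℝ E]

/-- The tensor `∂_{p_j} ∧ ∂_{x^j} = ∂_{p_j} ⊗ ∂_{x^j} - ∂_{x^j} ⊗ ∂_{p_j}` on `E × E*`, the space of
the coordinates `(x, p)`.  A covector `α` on `E × E*` has the components
`α ∘ inl = (α(∂_{x^j}))_j ∈ E*` and `α ∘ inr = (α(∂_{p_j}))_j ∈ E**`, and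
`∂_{p_j} ⊗ ∂_{x^j}` takes `(α, β)` to `(α ∘ inr) (β ∘ inl)`. -/
def canonicalModel (E : Type*) [NormedAddCommGroup E] [NormedSpace ℝ E] :
    Tensor2 (E × (E →L[ℝ] ℝ)) :=
  let P : Tensor2 (E × (E →L[ℝ] ℝ)) :=
    (ContinuousLinearMap.precomp ℝ
        (ContinuousLinearMap.precomp ℝ (ContinuousLinearMap.inl ℝ E (E →L[ℝ] ℝ)))) ∘L
      (ContinuousLinearMap.precomp ℝ (ContinuousLinearMap.inr ℝ E (E →L[ℝ] ℝ)))
  P - P.flip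

theorem canonicalModel_apply (α β : E × (E →L[ℝ] ℝ) →L[ℝ] ℝ) :
    canonicalModel E α β =
      α (0, β ∘L ContinuousLinearMap.inl ℝ E (E →L[ℝ] ℝ)) -
        β (0, α ∘L ContinuousLinearMap.inl ℝ E (E →L[ℝ] ℝ)) := rfl

/-- In the coordinates `(x, ẋ)`, the complete lift
`(∂Λ^{ij}/∂x^k) ẋ^k ∂_{ẋ^i} ⊗ ∂_{ẋ^j} + Λ^{ij} (∂_{x^i} ⊗ ∂_{ẋ^j} + ∂_{ẋ^i} ⊗ ∂_{x^j})`
at `(x, ẋ)` of the tensor `L = Λ^{ij} ∂_{x^i} ⊗ ∂_{x^j}`; here `inl` and `inr` send `∂_i` to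
`∂_{x^i}` and to `∂_{ẋ^i}`. The set `s` is the range of the coordinates (all of `E` for manifolds
without boundary). -/
def completeLiftModel (L : E → Tensor2 E) (s : Set E) (x w : E) : Tensor2 (E × E) :=
  Tensor2.map (ContinuousLinearMap.inr ℝ E E) (ContinuousLinearMap.inr ℝ E E)
      (fderivWithin ℝ L s x w) +
    Tensor2.map (ContinuousLinearMap.inl ℝ E E) (ContinuousLinearMap.inr ℝ E E) (L x) +
    Tensor2.map (ContinuousLinearMap.inr ℝ E E) (ContinuousLinearMap.inl ℝ E E) (L x)

end Model

/-! ### Tensor fields, one-forms and bundle morphisms on a manifold -/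

section Manifold

variable {E : Type*} [NormedAddCommGroup E] [NormedSpace ℝ E]
  {H : Type*} [TopologicalSpace H] (I : ModelWithCorners ℝ E H)
  {M : Type*} [TopologicalSpace M] [ChartedSpace H M]

instance [FiniteDimensional ℝ E] (x : M) : FiniteDimensional ℝ (TangentSpace I x) :=
  inferInstanceAs (FiniteDimensional ℝ E)

instance (x : M) : T2Space (TangentSpace I x) := inferInstanceAs (T2Space E)

/-- The derivative at `x` of the preferred chart `φ` at `p`, as a map from `T_x M` to the model space. -/
def dChart (p x : M) : TangentSpace I x →L[ℝ] E := mvfderiv I (extChartAt I p) x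

/-- The derivative at `y` of the inverse of the preferred chart `φ` at `p`, as a map from the model
space to `T M`. -/
def dChartSymm (p : M) (y : E) : E →L[ℝ] TangentSpace I ((extChartAt I p).symm y) :=
  (mfderivWithin 𝓘(ℝ, E) I (extChartAt I p).symm (Set.range I) y) ∘L
    (NormedSpace.fromTangentSpace y).symm.toContinuousLinearMap

/-- The inverse of `dChart I p p`, that is, the vectors `∂_{x^i}` at `p` itself. -/
def coordBasis (p : M) : E →L[ℝ] TangentSpace I p :=
  (dChart I p p).inverse

/-- (Not necessarily smooth) two-contravariant tensor fields. -/
abbrev TensorField2 (M : Type*) [TopologicalSpace M] [ChartedSpace H M] : Type _ :=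
  ∀ x : M, Tensor2 (TangentSpace I x)

/-- (Not necessarily smooth) one-forms. -/
abbrev Form1 (M : Type*) [TopologicalSpace M] [ChartedSpace H M] : Type _ :=
  ∀ x : M, TangentSpace I x →L[ℝ] ℝ

variable {I}

/-- The coordinate expression `(Λ^{ij})` of a tensor field in the preferred chart at `p`. -/
def TensorField2.inChart (Λ : TensorField2 I M) (p : M) (y : E) : Tensor2 E :=
  Tensor2.map (dChart I p ((extChartAt I p).symm y)) (dChart I p ((extChartAt I p).symm y))
    (Λ ((extChartAt I p).symm y))

/-- A tensor field is smooth if its components are smooth in the charts. -/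
def TensorField2.Smooth (Λ : TensorField2 I M) : Prop :=
  ∀ p : M, ContDiffOn ℝ ∞ (Λ.inChart p) (extChartAt I p).target

/-- Skew-symmetry, i.e. `Λ` is a bivector field. -/
def TensorField2.Skew (Λ : TensorField2 I M) : Prop :=
  ∀ (x : M) (α β : TangentSpace I x →L[ℝ] ℝ), Λ x α β = -Λ x β α

/-- The bracket `{f, g}_Λ = ⟨Λ, df ⊗ dg⟩` of functions. -/
def TensorField2.bracket (Λ : TensorField2 I M) (f g : M → ℝ) : M → ℝ :=
  fun x => Λ x (mvfderiv I f x) (mvfderiv I g x)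

/-- `Λ` is a Poisson tensor: it is skew-symmetric and `{·, ·}_Λ` satisfies the Jacobi identity on
smooth functions. -/
def TensorField2.IsPoisson (Λ : TensorField2 I M) : Prop :=
  Λ.Skew ∧ ∀ f g h : M → ℝ, ContMDiff I 𝓘(ℝ) ∞ f → ContMDiff I 𝓘(ℝ) ∞ g → ContMDiff I 𝓘(ℝ) ∞ h →
    ∀ x, Λ.bracket (Λ.bracket f g) h x =
      Λ.bracket f (Λ.bracket g h) x - Λ.bracket g (Λ.bracket f h) x

/-- The coordinate expression `(ν_i)` of a one-form in the preferred chart at `p`. -/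
def Form1.inChart (ν : Form1 I M) (p : M) (y : E) : E →L[ℝ] ℝ :=
  ν ((extChartAt I p).symm y) ∘L dChartSymm I p y

/-- A one-form is smooth if its components are smooth in the charts. -/
def Form1.Smooth (ν : Form1 I M) : Prop :=
  ∀ p : M, ContDiffOn ℝ ∞ (ν.inChart p) (extChartAt I p).target

/-- The exterior derivative `(dν)_x (u, v)` of a one-form, computed in the preferred chart at `x`:
it is the pull-back of `(u, v) ↦ D w(u)(v) - D w(v)(u)`, where `w` is the expression of `ν` in the
chart. -/
def Form1.extDeriv (ν : Form1 I M) (x : M) :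
    TangentSpace I x →L[ℝ] TangentSpace I x →L[ℝ] ℝ :=
  let D : E →L[ℝ] E →L[ℝ] ℝ := fderivWithin ℝ (ν.inChart x) (Set.range I) (extChartAt I x x)
  (ContinuousLinearMap.precomp ℝ (dChart I x x)) ∘L (D - D.flip) ∘L dChart I x x

variable [FiniteDimensional ℝ E]

/-- The morphism `♯_Λ : T*M → TM`, `♯_Λ(ω_x) = i_{ω_x} Λ(x)`. -/
def TensorField2.sharp (Λ : TensorField2 I M) (x : M) :
    (TangentSpace I x →L[ℝ] ℝ) →L[ℝ] TangentSpace I x :=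
  (Λ x).sharp

/-- The bracket `[μ, ν]_Λ = i_{♯_Λ μ} dν - i_{♯_Λ ν} dμ + d⟨Λ, μ ⊗ ν⟩` of one-forms. -/
def TensorField2.formBracket (Λ : TensorField2 I M) (μ ν : Form1 I M) : Form1 I M :=
  fun x => ν.extDeriv x (Λ.sharp x (μ x)) - μ.extDeriv x (Λ.sharp x (ν x)) +
    mvfderiv I (fun y => Λ y (μ y) (ν y)) x

end Manifold

/-! ### The tangent and cotangent bundles -/

section Bundles

variable {E : Type*} [NormedAddCommGroup E] [NormedSpace ℝ E]
  {H : Type*} [TopologicalSpace H] (I : ModelWithCorners ℝ E H)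
  (M : Type*) [TopologicalSpace M] [ChartedSpace H M]

/-- The total space of the cotangent bundle `T*M`. -/
abbrev CotangentBundle : Type _ :=
  Bundle.TotalSpace (E →L[ℝ] ℝ) (fun x : M => TangentSpace I x →L[ℝ] ℝ)

/-- The model with corners of `T*M`. -/
abbrev cotangentModel : ModelWithCorners ℝ (E × (E →L[ℝ] ℝ)) (ModelProd H (E →L[ℝ] ℝ)) :=
  I.prod 𝓘(ℝ, E →L[ℝ] ℝ)

variable {I M}

/-- Two tensor fields `P` on `N` and `Q` on `N'` are `ψ`-related, for a map `ψ : N → N'`, if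
`(Tψ ⊗ Tψ) P(q) = Q(ψ(q))` for all points `q` of `N`. -/
def Related {E₁ E₂ H₁ H₂ N N' : Type*} [NormedAddCommGroup E₁] [NormedSpace ℝ E₁]
    [NormedAddCommGroup E₂] [NormedSpace ℝ E₂] [TopologicalSpace H₁] [TopologicalSpace H₂]
    {I₁ : ModelWithCorners ℝ E₁ H₁} {I₂ : ModelWithCorners ℝ E₂ H₂}
    [TopologicalSpace N] [ChartedSpace H₁ N] [TopologicalSpace N'] [ChartedSpace H₂ N']
    (ψ : N → N') (P : TensorField2 I₁ N) (Q : TensorField2 I₂ N') : Prop :=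
  ∀ q : N, Tensor2.map (mfderiv I₁ I₂ ψ q) (mfderiv I₁ I₂ ψ q) (P q) = Q (ψ q)

variable [IsManifold I 1 M]

/-- The complete (tangent) lift `Λ^c` of `Λ` to `TM`. The preferred chart of `TM` at `v ∈ T_x M` is
the one with the coordinates `(x, ẋ)` adapted to the preferred chart of `M` at `x`. -/
def TensorField2.completeLift (Λ : TensorField2 I M) :
    TensorField2 I.tangent (TangentBundle I M) := fun v =>
  Tensor2.map (coordBasis I.tangent v) (coordBasis I.tangent v)
    (completeLiftModel (Λ.inChart v.proj) (Set.range I)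
      (extChartAt I.tangent v v).1 (extChartAt I.tangent v v).2)

variable (I M) in
/-- The canonical Poisson tensor `Λ_M = ∂_{p_j} ∧ ∂_{x^j}` on `T*M`. The preferred chart of `T*M` at
`ξ ∈ T*_x M` is the one with the coordinates `(x, p)` adapted to the preferred chart of `M` at
`x`. -/
def canonicalPoisson : TensorField2 (cotangentModel I) (CotangentBundle I M) := fun ξ =>
  Tensor2.map (coordBasis (cotangentModel I) ξ) (coordBasis (cotangentModel I) ξ)
    (canonicalModel E)

variable (I M) in
/-- Fibrewise linear maps `T*M → TM` over the identity of `M`. -/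
abbrev BundleMap : Type _ := ∀ x : M, (TangentSpace I x →L[ℝ] ℝ) →L[ℝ] TangentSpace I x

/-- The map `T*M → TM` of total spaces. -/
def BundleMap.total (F : BundleMap I M) (ξ : CotangentBundle I M) : TangentBundle I M :=
  ⟨ξ.proj, F ξ.proj ξ.snd⟩

/-- `F` is a (smooth) vector bundle morphism `T*M → TM` over the identity of `M`. -/
def BundleMap.Smooth (F : BundleMap I M) : Prop :=
  ContMDiff (cotangentModel I) I.tangent ∞ F.total

/-- `F` is a homomorphism of the bracket `[·, ·]_Λ` into the Lie bracket of vector fields: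
`F([μ, ν]_Λ) = [F(μ), F(ν)]` for all smooth one-forms `μ`, `ν`. -/
def BundleMap.IsBracketHom [FiniteDimensional ℝ E] (F : BundleMap I M) (Λ : TensorField2 I M) :
    Prop :=
  ∀ μ ν : Form1 I M, μ.Smooth → ν.Smooth → ∀ x : M,
    F x (Λ.formBracket μ ν x) =
      VectorField.mlieBracket I (fun y => F y (μ y)) (fun y => F y (ν y)) x

/-- The support of `Λ` is contained in that of `F`: `F` does not vanish identically on an open set
unless `Λ` does. -/
def BundleMap.SupportContains (F : BundleMap I M) (Λ : TensorField2 I M) : Prop :=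
  ∀ U : Set M, IsOpen U → (∀ x ∈ U, F x = 0) → ∀ x ∈ U, Λ x = 0

end Bundles

end PoissonChar

end

section

open scoped Topology
open Filter

noncomputable section

namespace PoissonChar

/-! ### Linear algebra of contravariant 2-tensors -/

section Linear

/-! Every condition in the theorem is local and of first order. At a point x it involves only the
value `L` and derivative `D` of Λ and the value `F` and derivative `G` of the morphism, all read at
the centre of the preferred chart at x, so no change of charts is needed. Smooth one-forms realise
every 1-jet at x (`exists_form_jet_eq`) and smooth functions every differential. The conditions
therefore become pointwise algebra: `HomModel`, `RelatedModel`, `JacobiModel` (see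
`bracketHomAt_iff`, `related_iff_relatedModel`, `isPoisson_iff`).

The algebra is rigid. In F([μ,ν]) = [F μ, F ν], perturbing the derivative of ν by a rank one map
forces F = 0 or F = ♯; in the second case, perturbing the derivative of μ forces `L` to be skew
(`HomModel.eq_zero_or`). In the relatedness equation, the two mixed base-fibre components each
determine F, and comparing them gives skew-symmetry (`RelatedModel.eq_of_neg`). Once F = ♯ and `L`
is skew, everything cancels except the cyclic sum of D(♯a)(b,c), so both conditions say that the
Schouten bracket vanishes (`homModel_sharp_iff`, `relatedModel_sharp_iff`).

For bracket homomorphisms the alternative F = 0 or F = ♯ still has to be globalised. In (vi), the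
set where F ≠ ♯ is open and F vanishes on it, so the support hypothesis makes Λ, hence ♯, vanish
there too. In (vii), Λ₁ = Λ on the open set where ♯ ≠ 0, and at the other points applying ♯ kills
both brackets of forms. -/

theorem eq_of_forall_dual {V : Type*} [NormedAddCommGroup V] [NormedSpace ℝ V] {u v : V}
    (h : ∀ β : V →L[ℝ] ℝ, β u = β v) : u = v :=
  SeparatingDual.eq_iff_forall_dual_eq.2 h

variable {E : Type*} [NormedAddCommGroup E] [NormedSpace ℝ E] [FiniteDimensional ℝ E]

/-- The map `P ↦ ♯_P` as a continuous linear map. -/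
def Tensor2.sharpL (E : Type*) [NormedAddCommGroup E] [NormedSpace ℝ E] [FiniteDimensional ℝ E] :
    Tensor2 E →L[ℝ] (E →L[ℝ] ℝ) →L[ℝ] E :=
  LinearMap.toContinuousLinearMap
    { toFun := fun P => P.sharp
      map_add' := fun P Q => by
        ext α
        refine eq_of_forall_dual fun β => ?_
        simp [Tensor2.apply_sharp]
      map_smul' := fun c P => by
        ext α
        refine eq_of_forall_dual fun β => ?_
        simp [Tensor2.apply_sharp] }

@[simp]
theorem Tensor2.sharpL_apply (P : Tensor2 E) : Tensor2.sharpL E P = P.sharp := rfl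

theorem Tensor2.sharp_injective {P Q : Tensor2 E} (h : P.sharp = Q.sharp) : P = Q := by
  ext α β
  rw [← P.apply_sharp, h, Q.apply_sharp]

omit [FiniteDimensional ℝ E] in
theorem hasFDerivAt_tensor_apply {L : E → Tensor2 E} {m n : E → E →L[ℝ] ℝ}
    {D : E →L[ℝ] Tensor2 E} {A B : E →L[ℝ] E →L[ℝ] ℝ} {y : E} (hL : HasFDerivAt L D y)
    (hm : HasFDerivAt m A y) (hn : HasFDerivAt n B y) :
    HasFDerivAt (fun z => L z (m z) (n z))
      ((L y).flip (n y) ∘L A + L y (m y) ∘L B + (D.flip (m y)).flip (n y)) y := by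
  refine ((hL.clm_apply hm).clm_apply hn).congr_fderiv ?_
  ext v
  simp
  ring

/-- The expression in coordinates of the bracket of one-forms with the values `m`, `n` and the
derivatives `A`, `B`, with respect to a tensor with value `L` and derivative `D`. -/
def bracketModel (L : Tensor2 E) (D : E →L[ℝ] Tensor2 E) (m n : E →L[ℝ] ℝ)
    (A B : E →L[ℝ] E →L[ℝ] ℝ) : E →L[ℝ] ℝ :=
  (B - B.flip) (L.sharp m) - (A - A.flip) (L.sharp n) +
    (L.flip n ∘L A + L m ∘L B + (D.flip m).flip n)

/-- The term B v (♯m) coming from dν cancels one term of d⟨Λ, μ ⊗ ν⟩ with no symmetry assumption.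
The corresponding terms in `A` only add up to the symmetric part of `L`, and this asymmetry is what
later detects skewness. -/
theorem bracketModel_apply (L : Tensor2 E) (D : E →L[ℝ] Tensor2 E) (m n : E →L[ℝ] ℝ)
    (A B : E →L[ℝ] E →L[ℝ] ℝ) (v : E) :
    bracketModel L D m n A B v =
      B (L.sharp m) v - A (L.sharp n) v + (L n (A v) + L (A v) n) + D v m n := by
  simp [bracketModel, ← Tensor2.apply_sharp]
  ring

/-- The condition, at a point and in coordinates, that a morphism with value `F` and derivative `G`
takes brackets of one-forms to Lie brackets. -/
def HomModel (F : (E →L[ℝ] ℝ) →L[ℝ] E) (G : E →L[ℝ] (E →L[ℝ] ℝ) →L[ℝ] E)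
    (L : Tensor2 E) (D : E →L[ℝ] Tensor2 E) : Prop :=
  ∀ (m n : E →L[ℝ] ℝ) (A B : E →L[ℝ] E →L[ℝ] ℝ),
    F (bracketModel L D m n A B) = (G (F m) n + F (B (F m))) - (G (F n) m + F (A (F n)))

/-- The vanishing of the Schouten bracket of a bivector with value `L` and derivative `D`. -/
def JacobiModel (L : Tensor2 E) (D : E →L[ℝ] Tensor2 E) : Prop :=
  ∀ a b c : E →L[ℝ] ℝ, D (L.sharp a) b c + D (L.sharp b) c a + D (L.sharp c) a b = 0

theorem HomModel.eq_zero_or {F : (E →L[ℝ] ℝ) →L[ℝ] E} {G : E →L[ℝ] (E →L[ℝ] ℝ) →L[ℝ] E}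
    {L : Tensor2 E} {D : E →L[ℝ] Tensor2 E} (h : HomModel F G L D) :
    F = 0 ∨ (F = L.sharp ∧ ∀ α β, L α β = -L β α) := by
  by_cases hF : F = 0
  · exact Or.inl hF
  obtain ⟨n, hn⟩ : ∃ n, F n ≠ 0 := by
    by_contra! H
    exact hF (ContinuousLinearMap.ext H)
  have hFS : F = L.sharp := by
    ext m
    refine eq_of_forall_dual fun ℓ => ?_
    -- Adding ℓ ⊗ n to the derivative of ν changes the left side by ℓ(♯m) F n and the right side by
    -- ℓ(F m) F n. Since F n ≠ 0, the two factors agree.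
    have h0 := h m n 0 0
    have h1 := h m n 0 (ContinuousLinearMap.smulRight ℓ n)
    have e : bracketModel L D m n 0 (ContinuousLinearMap.smulRight ℓ n) =
        bracketModel L D m n 0 0 + ℓ (L.sharp m) • n := by
      ext v
      simp [bracketModel_apply]
      ring
    rw [e, map_add, h0] at h1
    have : (ℓ (F m) - ℓ (L.sharp m)) • F n = 0 := by
      simp at h1
      rw [sub_smul, sub_eq_zero]
      linear_combination (norm := module) (-1 : ℝ) • h1
    rcases smul_eq_zero.1 this with h | h
    · linarith
    · exact absurd h hn
  refine Or.inr ⟨hFS, fun α β => ?_⟩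
  have h0 := h α β 0 0
  obtain ⟨ℓ, hℓ⟩ : ∃ ℓ, F ℓ ≠ 0 := ⟨n, hn⟩
  -- Now the derivative of μ is perturbed by ℓ ⊗ α. Keeping `u` opaque leaves u(♯β) intact, so that
  -- it cancels against u(F β) and only the symmetric part of `L` times F ℓ survives.
  obtain ⟨u, hu⟩ : ∃ u : E →L[ℝ] E →L[ℝ] ℝ, u = ContinuousLinearMap.smulRight ℓ α := ⟨_, rfl⟩
  have h1 := h α β u 0
  have e : bracketModel L D α β u 0 =
      bracketModel L D α β 0 0 - u (L.sharp β) + (L β α + L α β) • ℓ := by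
    ext v
    simp [bracketModel_apply, hu]
    ring
  rw [e, map_add, map_sub, h0, ← hFS] at h1
  have : (L β α + L α β) • F ℓ = 0 := by
    simp at h1
    linear_combination (norm := module) (1 : ℝ) • h1
  rcases smul_eq_zero.1 this with h | h
  · linarith
  · exact absurd h hℓ

/-- For skew `L` the derivatives `A`, `B` of the forms enter both sides identically. Paired with a
covector c, the difference of the sides is minus the cyclic sum; `hG` expresses that `G` is the
derivative of ♯. -/
theorem homModel_sharp_iff {G : E →L[ℝ] (E →L[ℝ] ℝ) →L[ℝ] E} {L : Tensor2 E}
    {D : E →L[ℝ] Tensor2 E} (hG : ∀ u α β, β (G u α) = D u α β)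
    (hL : ∀ α β, L α β = -L β α) (hD : ∀ u α β, D u α β = -D u β α) :
    HomModel L.sharp G L D ↔ JacobiModel L D := by
  have key : ∀ (m n c : E →L[ℝ] ℝ) (A B : E →L[ℝ] E →L[ℝ] ℝ),
      c (L.sharp (bracketModel L D m n A B)) - c ((G (L.sharp m) n + L.sharp (B (L.sharp m))) -
        (G (L.sharp n) m + L.sharp (A (L.sharp n)))) =
      -(D (L.sharp m) n c + D (L.sharp n) c m + D (L.sharp c) m n) := by
    intro m n c A B
    have e : bracketModel L D m n A B =
        B (L.sharp m) - A (L.sharp n) + (D.flip m).flip n := by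
      ext v
      simp [bracketModel_apply, hL n (A v)]
    have e2 : L ((D.flip m).flip n) c = - D (L.sharp c) m n := by
      rw [hL, ← L.apply_sharp]; rfl
    rw [e]
    simp only [map_add, map_sub, hG, L.apply_sharp,
      e2]
    rw [hD (L.sharp n) c m]
    ring
  constructor
  · intro h a b c
    have := key a b c 0 0
    rw [h a b 0 0] at this
    linarith
  · intro h m n A B
    refine eq_of_forall_dual fun c => ?_
    have := key m n c A B
    rw [h m n c] at this
    linarith

/-- The derivative `(u, q) ↦ (u, G u p + F q)` at `(x, p)` of a morphism `(x, p) ↦ (x, F_x p)`,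
where `F` is the value of the morphism at `x` and `G` is its derivative. -/
def morphismDeriv (F : (E →L[ℝ] ℝ) →L[ℝ] E) (G : E →L[ℝ] (E →L[ℝ] ℝ) →L[ℝ] E) (p : E →L[ℝ] ℝ) :
    E × (E →L[ℝ] ℝ) →L[ℝ] E × E :=
  (ContinuousLinearMap.fst ℝ E (E →L[ℝ] ℝ)).prod
    ((G.flip p).coprod F)

/-- The value at `(x, w)` of the complete lift of a tensor with value `L` and derivative `D`
at `x`. -/
def liftModel (L : Tensor2 E) (D : E →L[ℝ] Tensor2 E) (w : E) : Tensor2 (E × E) :=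
  Tensor2.map (ContinuousLinearMap.inr ℝ E E) (ContinuousLinearMap.inr ℝ E E) (D w) +
    Tensor2.map (ContinuousLinearMap.inl ℝ E E) (ContinuousLinearMap.inr ℝ E E) L +
    Tensor2.map (ContinuousLinearMap.inr ℝ E E) (ContinuousLinearMap.inl ℝ E E) L

/-- The condition, over a point and in coordinates, that the canonical Poisson tensor and a complete
lift are related by a morphism. -/
def RelatedModel (F : (E →L[ℝ] ℝ) →L[ℝ] E) (G : E →L[ℝ] (E →L[ℝ] ℝ) →L[ℝ] E)
    (L : Tensor2 E) (D : E →L[ℝ] Tensor2 E) : Prop :=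
  ∀ p, (canonicalModel E).map (morphismDeriv F G p) (morphismDeriv F G p) = liftModel L D (F p)

omit [FiniteDimensional ℝ E] in
-- Covectors on E × E are split into a base part (`a`, `c`) and a fibre part (`b`, `d`). The
-- morphism pulls (a, b) back to a + b ∘ G(·)p on the base and b ∘ F on the fibre.
theorem relatedModel_iff {F : (E →L[ℝ] ℝ) →L[ℝ] E} {G : E →L[ℝ] (E →L[ℝ] ℝ) →L[ℝ] E}
    {L : Tensor2 E} {D : E →L[ℝ] Tensor2 E} :
    RelatedModel F G L D ↔ ∀ p a b c d : E →L[ℝ] ℝ,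
      b (F (c + d ∘L G.flip p)) - d (F (a + b ∘L G.flip p)) = D (F p) b d + L a d + L b c := by
  have e1 : ∀ p a b c d : E →L[ℝ] ℝ,
      (canonicalModel E).map (morphismDeriv F G p) (morphismDeriv F G p) (a.coprod b) (c.coprod d) =
      b (F (c + d ∘L G.flip p)) - d (F (a + b ∘L G.flip p)) := by
    intro p a b c d
    have : ∀ a b : E →L[ℝ] ℝ, (a.coprod b ∘L morphismDeriv F G p) ∘L
        ContinuousLinearMap.inl ℝ E (E →L[ℝ] ℝ) = a + b ∘L G.flip p := by
      intro a b
      ext v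
      simp [morphismDeriv]
    rw [Tensor2.map_apply, canonicalModel_apply, this, this]
    simp [morphismDeriv]
  have e2 : ∀ p a b c d : E →L[ℝ] ℝ,
      liftModel L D (F p) (a.coprod b) (c.coprod d) = D (F p) b d + L a d + L b c := by
    intro p a b c d
    have h1 : ∀ a b : E →L[ℝ] ℝ, a.coprod b ∘L ContinuousLinearMap.inl ℝ E E = a := by
      intro a b; ext; simp
    have h2 : ∀ a b : E →L[ℝ] ℝ, a.coprod b ∘L ContinuousLinearMap.inr ℝ E E = b := by
      intro a b; ext; simp
    simp only [liftModel, add_apply, Tensor2.map_apply, h1, h2]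
  constructor
  · intro h p a b c d
    rw [← e1, ← e2, h p]
  · intro h p
    ext α β : 2
    have dec : ∀ α : E × E →L[ℝ] ℝ, α = (α ∘L ContinuousLinearMap.inl ℝ E E).coprod
        (α ∘L ContinuousLinearMap.inr ℝ E E) := by
      intro α; ext <;> simp
    rw [dec α, dec β, e1, e2, h]

theorem RelatedModel.eq_of_neg {F : (E →L[ℝ] ℝ) →L[ℝ] E}
    {G : E →L[ℝ] (E →L[ℝ] ℝ) →L[ℝ] E} {L : Tensor2 E} {D : E →L[ℝ] Tensor2 E}
    (h : RelatedModel F G L D) :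
    F = (-L).sharp ∧ ∀ α β, L α β = -L β α := by
  rw [relatedModel_iff] at h
  -- Every term with `G` or `D` contains both `b` and `d`. Setting b = c = 0 here, and a = d = 0
  -- below, thus isolates one mixed component each time.
  have h1 : ∀ a d, d (F a) = - L a d := by
    intro a d
    have := h 0 a 0 0 d
    simp at this
    linarith
  have h2 : ∀ b c, b (F c) = L b c := by
    intro b c
    have := h 0 0 b c 0
    simpa using this
  refine ⟨?_, fun α β => by rw [← h2, h1]⟩
  ext a
  refine eq_of_forall_dual fun d => ?_
  rw [Tensor2.apply_sharp, h1]
  rfl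

/-- The mixed components hold by skewness of `L`, so `a` and `c` drop out. The fibre-fibre component
is the cyclic sum evaluated at p, b, d. -/
theorem relatedModel_sharp_iff {G : E →L[ℝ] (E →L[ℝ] ℝ) →L[ℝ] E} {L : Tensor2 E}
    {D : E →L[ℝ] Tensor2 E} (hG : ∀ u α β, β (G u α) = D u α β)
    (hL : ∀ α β, L α β = -L β α) (hD : ∀ u α β, D u α β = -D u β α) :
    RelatedModel L.sharp G (-L) (-D) ↔ JacobiModel L D := by
  rw [relatedModel_iff]
  have key : ∀ p a b c d : E →L[ℝ] ℝ,
      b (L.sharp (c + d ∘L G.flip p)) - d (L.sharp (a + b ∘L G.flip p)) -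
        ((-D) (L.sharp p) b d + (-L) a d + (-L) b c) =
      D (L.sharp p) b d + D (L.sharp b) d p + D (L.sharp d) p b := by
    intro p a b c d
    have e : ∀ b d : E →L[ℝ] ℝ, L (d ∘L G.flip p) b = D (L.sharp b) d p := by
      intro b d
      rw [hL, ← L.apply_sharp, hD]
      simp [hG]
    simp only [L.apply_sharp, map_add, e,
      neg_apply]
    rw [hD (L.sharp d) b p, hL c b]
    ring
  constructor
  · intro h p b d
    have := key p 0 b 0 d
    rw [h] at this
    linarith
  · intro h p a b c d
    have := key p a b c d
    rw [h p b d] at this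
    linarith

end Linear

/-! ### Calculus in charts -/

section Charts

variable {E : Type*} [NormedAddCommGroup E] [NormedSpace ℝ E]
  {M : Type*} [TopologicalSpace M] [ChartedSpace E M]

theorem extChartAt_target_mem_nhds_of_mem {p : M} {y : E}
    (hy : y ∈ (extChartAt 𝓘(ℝ, E) p).target) : (extChartAt 𝓘(ℝ, E) p).target ∈ 𝓝 y :=
  (isOpen_extChartAt_target p).mem_nhds hy

variable [IsManifold 𝓘(ℝ, E) ∞ M]

theorem dChart_dChartSymm {p : M} {y : E} (hy : y ∈ (extChartAt 𝓘(ℝ, E) p).target) (v : E) :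
    dChart 𝓘(ℝ, E) p ((extChartAt 𝓘(ℝ, E) p).symm y) (dChartSymm 𝓘(ℝ, E) p y v) = v :=
  DFunLike.congr_fun (mfderiv_extChartAt_comp_mfderivWithin_extChartAt_symm hy) v

theorem dChartSymm_dChart {p : M} {y : E} (hy : y ∈ (extChartAt 𝓘(ℝ, E) p).target)
    (v : TangentSpace 𝓘(ℝ, E) ((extChartAt 𝓘(ℝ, E) p).symm y)) :
    dChartSymm 𝓘(ℝ, E) p y (dChart 𝓘(ℝ, E) p ((extChartAt 𝓘(ℝ, E) p).symm y) v) = v :=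
  DFunLike.congr_fun (mfderivWithin_extChartAt_symm_comp_mfderiv_extChartAt hy) v

/-- The derivative of a chart as an isomorphism. -/
def chartEquiv {p : M} {y : E} (hy : y ∈ (extChartAt 𝓘(ℝ, E) p).target) :
    TangentSpace 𝓘(ℝ, E) ((extChartAt 𝓘(ℝ, E) p).symm y) ≃L[ℝ] E :=
  .equivOfInverse (dChart 𝓘(ℝ, E) p ((extChartAt 𝓘(ℝ, E) p).symm y)) (dChartSymm 𝓘(ℝ, E) p y)
    (dChartSymm_dChart hy) (dChart_dChartSymm hy)

/-- The existential form allows the base point to be rewritten by `left_inv` inside the type of the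
isomorphism. -/
theorem exists_dChart_eq {p z : M} (hz : z ∈ (extChartAt 𝓘(ℝ, E) p).source) :
    ∃ e : TangentSpace 𝓘(ℝ, E) z ≃L[ℝ] E, (e : TangentSpace 𝓘(ℝ, E) z →L[ℝ] E) =
      dChart 𝓘(ℝ, E) p z := by
  have h2 : ∃ e : TangentSpace 𝓘(ℝ, E) ((extChartAt 𝓘(ℝ, E) p).symm (extChartAt 𝓘(ℝ, E) p z))
      ≃L[ℝ] E, e.toContinuousLinearMap = dChart 𝓘(ℝ, E) p _ :=
    ⟨chartEquiv (p := p) ((extChartAt 𝓘(ℝ, E) p).map_source hz), rfl⟩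
  rwa [(extChartAt 𝓘(ℝ, E) p).left_inv hz] at h2

theorem dChart_injective {p z : M} (hz : z ∈ (extChartAt 𝓘(ℝ, E) p).source) :
    Function.Injective (dChart 𝓘(ℝ, E) p z) := by
  obtain ⟨e, he⟩ := exists_dChart_eq hz
  rw [← he]
  exact e.injective

theorem exists_comp_dChart_eq {p z : M} (hz : z ∈ (extChartAt 𝓘(ℝ, E) p).source)
    (α : TangentSpace 𝓘(ℝ, E) z →L[ℝ] ℝ) : ∃ a : E →L[ℝ] ℝ, α = a ∘L dChart 𝓘(ℝ, E) p z := by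
  obtain ⟨e, he⟩ := exists_dChart_eq hz
  refine ⟨α ∘L e.symm.toContinuousLinearMap, ?_⟩
  ext v
  simp [← he]

theorem comp_dChart_injective {p z : M} (hz : z ∈ (extChartAt 𝓘(ℝ, E) p).source)
    {a b : E →L[ℝ] ℝ} (h : a ∘L dChart 𝓘(ℝ, E) p z = b ∘L dChart 𝓘(ℝ, E) p z) : a = b := by
  obtain ⟨e, he⟩ := exists_dChart_eq hz
  ext v
  have := DFunLike.congr_fun h (e.symm v)
  simpa [← he] using this

/-- Differentials of functions in a chart. -/
theorem mvfderiv_eq_fderiv_comp {V : Type*} [NormedAddCommGroup V] [NormedSpace ℝ V] {f : M → V}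
    {p z : M} (hz : z ∈ (extChartAt 𝓘(ℝ, E) p).source)
    (hf : DifferentiableAt ℝ (fun y => f ((extChartAt 𝓘(ℝ, E) p).symm y))
      (extChartAt 𝓘(ℝ, E) p z)) :
    mvfderiv 𝓘(ℝ, E) f z =
      fderiv ℝ (fun y => f ((extChartAt 𝓘(ℝ, E) p).symm y)) (extChartAt 𝓘(ℝ, E) p z) ∘L
        dChart 𝓘(ℝ, E) p z := by
  have h1 : f =ᶠ[𝓝 z] (fun y => f ((extChartAt 𝓘(ℝ, E) p).symm y)) ∘ extChartAt 𝓘(ℝ, E) p := by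
    filter_upwards [(isOpen_extChartAt_source p).mem_nhds hz] with w hw
    rw [Function.comp_apply, (extChartAt 𝓘(ℝ, E) p).left_inv hw]
  have h2 : mfderiv 𝓘(ℝ, E) 𝓘(ℝ, V) f z = mfderiv 𝓘(ℝ, E) 𝓘(ℝ, V)
      ((fun y => f ((extChartAt 𝓘(ℝ, E) p).symm y)) ∘ extChartAt 𝓘(ℝ, E) p) z :=
    h1.mfderiv_eq
  have h3 := mfderiv_comp (I := 𝓘(ℝ, E)) (I' := 𝓘(ℝ, E)) (I'' := 𝓘(ℝ, V)) z
    hf.mdifferentiableAt (mdifferentiableAt_extChartAt (by simpa using hz))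
  rw [mfderiv_eq_fderiv] at h3
  exact h2.trans h3

theorem inChart_form_comp_dChart (μ : Form1 𝓘(ℝ, E) M) {p z : M}
    (hz : z ∈ (extChartAt 𝓘(ℝ, E) p).source) :
    μ.inChart p (extChartAt 𝓘(ℝ, E) p z) ∘L dChart 𝓘(ℝ, E) p z = μ z := by
  have h : ∀ y ∈ (extChartAt 𝓘(ℝ, E) p).target,
      μ.inChart p y ∘L dChart 𝓘(ℝ, E) p ((extChartAt 𝓘(ℝ, E) p).symm y) =
        μ ((extChartAt 𝓘(ℝ, E) p).symm y) := by
    intro y hy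
    ext v
    exact congrArg _ (dChartSymm_dChart hy v)
  have := h _ ((extChartAt 𝓘(ℝ, E) p).map_source hz)
  rwa [(extChartAt 𝓘(ℝ, E) p).left_inv hz] at this

omit [IsManifold 𝓘(ℝ, E) ∞ M] in
theorem inChart_tensor_apply (Λ : TensorField2 𝓘(ℝ, E) M) {p z : M}
    (hz : z ∈ (extChartAt 𝓘(ℝ, E) p).source) (a b : E →L[ℝ] ℝ) :
    Λ.inChart p (extChartAt 𝓘(ℝ, E) p z) a b =
      Λ z (a ∘L dChart 𝓘(ℝ, E) p z) (b ∘L dChart 𝓘(ℝ, E) p z) := by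
  simp only [TensorField2.inChart, Tensor2.map_apply]
  rw [(extChartAt 𝓘(ℝ, E) p).left_inv hz]

/-- The coordinate expression of a bundle morphism in the preferred chart at `p`. -/
def BundleMap.inChart (F : BundleMap 𝓘(ℝ, E) M) (p : M) (y : E) : (E →L[ℝ] ℝ) →L[ℝ] E :=
  dChart 𝓘(ℝ, E) p ((extChartAt 𝓘(ℝ, E) p).symm y) ∘L F ((extChartAt 𝓘(ℝ, E) p).symm y) ∘L
    ContinuousLinearMap.precomp ℝ (dChart 𝓘(ℝ, E) p ((extChartAt 𝓘(ℝ, E) p).symm y))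

omit [IsManifold 𝓘(ℝ, E) ∞ M] in
theorem BundleMap.inChart_apply (F : BundleMap 𝓘(ℝ, E) M) {p z : M}
    (hz : z ∈ (extChartAt 𝓘(ℝ, E) p).source) (a : E →L[ℝ] ℝ) :
    F.inChart p (extChartAt 𝓘(ℝ, E) p z) a =
      dChart 𝓘(ℝ, E) p z (F z (a ∘L dChart 𝓘(ℝ, E) p z)) := by
  simp only [BundleMap.inChart]
  rw [(extChartAt 𝓘(ℝ, E) p).left_inv hz]
  rfl

theorem BundleMap.eq_of_inChart_eq {F G : BundleMap 𝓘(ℝ, E) M} {p z : M}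
    (hz : z ∈ (extChartAt 𝓘(ℝ, E) p).source)
    (h : F.inChart p (extChartAt 𝓘(ℝ, E) p z) = G.inChart p (extChartAt 𝓘(ℝ, E) p z)) :
    F z = G z := by
  ext α : 1
  obtain ⟨a, rfl⟩ := exists_comp_dChart_eq hz α
  refine dChart_injective hz ?_
  rw [← F.inChart_apply hz, h, G.inChart_apply hz]

theorem tensor_eq_of_inChart_eq {P Q : TensorField2 𝓘(ℝ, E) M} {p z : M}
    (hz : z ∈ (extChartAt 𝓘(ℝ, E) p).source)
    (h : P.inChart p (extChartAt 𝓘(ℝ, E) p z) = Q.inChart p (extChartAt 𝓘(ℝ, E) p z)) :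
    P z = Q z := by
  ext α β : 2
  obtain ⟨a, rfl⟩ := exists_comp_dChart_eq hz α
  obtain ⟨b, rfl⟩ := exists_comp_dChart_eq hz β
  rw [← inChart_tensor_apply P hz, h, inChart_tensor_apply Q hz]

omit [IsManifold 𝓘(ℝ, E) ∞ M] in
theorem inChart_neg (P : TensorField2 𝓘(ℝ, E) M) (p : M) :
    TensorField2.inChart (-P) p = -P.inChart p := rfl

theorem skew_iff_inChart {Λ : TensorField2 𝓘(ℝ, E) M} {p z : M}
    (hz : z ∈ (extChartAt 𝓘(ℝ, E) p).source) :
    (∀ α β, Λ z α β = -Λ z β α) ↔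
      ∀ a b, Λ.inChart p (extChartAt 𝓘(ℝ, E) p z) a b =
        -Λ.inChart p (extChartAt 𝓘(ℝ, E) p z) b a := by
  constructor
  · intro h a b
    rw [inChart_tensor_apply Λ hz, inChart_tensor_apply Λ hz, h]
  · intro h α β
    obtain ⟨a, rfl⟩ := exists_comp_dChart_eq hz α
    obtain ⟨b, rfl⟩ := exists_comp_dChart_eq hz β
    rw [← inChart_tensor_apply Λ hz, ← inChart_tensor_apply Λ hz, h]

omit [IsManifold 𝓘(ℝ, E) ∞ M] in
theorem TensorField2.Smooth.differentiableAt {Λ : TensorField2 𝓘(ℝ, E) M} (hΛ : Λ.Smooth)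
    (x : M) : DifferentiableAt ℝ (Λ.inChart x) (extChartAt 𝓘(ℝ, E) x x) :=
  ((hΛ x).contDiffAt (extChartAt_target_mem_nhds x)).differentiableAt (by simp)

omit [IsManifold 𝓘(ℝ, E) ∞ M] in
theorem Form1.Smooth.differentiableAt {μ : Form1 𝓘(ℝ, E) M} (hμ : μ.Smooth)
    (x : M) : DifferentiableAt ℝ (μ.inChart x) (extChartAt 𝓘(ℝ, E) x x) :=
  ((hμ x).contDiffAt (extChartAt_target_mem_nhds x)).differentiableAt (by simp)

omit [IsManifold 𝓘(ℝ, E) ∞ M] in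
theorem TensorField2.Smooth.neg {Λ : TensorField2 𝓘(ℝ, E) M} (hΛ : Λ.Smooth) :
    TensorField2.Smooth (-Λ) := fun p => (hΛ p).neg

omit [IsManifold 𝓘(ℝ, E) ∞ M] in
-- Skewness holds on a whole neighbourhood in the chart, so it may be differentiated.
theorem fderiv_skew {Λ : TensorField2 𝓘(ℝ, E) M} (hΛ : Λ.Smooth) (hs : Λ.Skew) (x : M) (u : E)
    (a b : E →L[ℝ] ℝ) :
    fderiv ℝ (Λ.inChart x) (extChartAt 𝓘(ℝ, E) x x) u a b =
      -fderiv ℝ (Λ.inChart x) (extChartAt 𝓘(ℝ, E) x x) u b a := by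
  have hd := (hΛ.differentiableAt x).hasFDerivAt
  have key : ∀ a b : E →L[ℝ] ℝ, HasFDerivAt (fun y => Λ.inChart x y a b)
      (((fderiv ℝ (Λ.inChart x) (extChartAt 𝓘(ℝ, E) x x)).flip a).flip b)
      (extChartAt 𝓘(ℝ, E) x x) := fun a b =>
    (hasFDerivAt_tensor_apply hd (hasFDerivAt_const a _) (hasFDerivAt_const b _)).congr_fderiv
      (by ext v; simp)
  have h1 : (fun y => Λ.inChart x y a b) =ᶠ[𝓝 (extChartAt 𝓘(ℝ, E) x x)]
      -(fun y => Λ.inChart x y b a) := by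
    filter_upwards [extChartAt_target_mem_nhds x] with y hy
    exact hs _ _ _
  have h2 := (key a b).unique ((key b a).neg.congr_of_eventuallyEq h1)
  exact DFunLike.congr_fun h2 u

variable [FiniteDimensional ℝ E]

omit [IsManifold 𝓘(ℝ, E) ∞ M] in
theorem inChart_sharp (Λ : TensorField2 𝓘(ℝ, E) M) (p : M) (y : E) :
    BundleMap.inChart Λ.sharp p y = (Λ.inChart p y).sharp := by
  ext a
  refine eq_of_forall_dual fun b => ?_
  rw [Tensor2.apply_sharp]
  exact Tensor2.apply_sharp _ _ (b ∘L dChart 𝓘(ℝ, E) p _)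

omit [IsManifold 𝓘(ℝ, E) ∞ M] in
-- In coordinates ♯_Λ is the components of Λ followed by the fixed linear map `Tensor2.sharpL`. This
-- supplies the relation between `G` and `D` required by the algebraic criteria.
theorem hasFDerivAt_sharp {Λ : TensorField2 𝓘(ℝ, E) M} (hΛ : Λ.Smooth) (x : M) :
    HasFDerivAt (BundleMap.inChart Λ.sharp x)
      (Tensor2.sharpL E ∘L fderiv ℝ (Λ.inChart x) (extChartAt 𝓘(ℝ, E) x x))
      (extChartAt 𝓘(ℝ, E) x x) := by
  have : BundleMap.inChart Λ.sharp x = Tensor2.sharpL E ∘ Λ.inChart x :=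
    funext fun y => inChart_sharp Λ x y
  rw [this]
  exact (Tensor2.sharpL E).hasFDerivAt.comp _ (hΛ.differentiableAt x).hasFDerivAt

theorem formBracket_eq {Λ : TensorField2 𝓘(ℝ, E) M} (hΛ : Λ.Smooth) {μ ν : Form1 𝓘(ℝ, E) M}
    (hμ : μ.Smooth) (hν : ν.Smooth) (x : M) :
    Λ.formBracket μ ν x =
      bracketModel (Λ.inChart x (extChartAt 𝓘(ℝ, E) x x))
        (fderiv ℝ (Λ.inChart x) (extChartAt 𝓘(ℝ, E) x x))
        (μ.inChart x (extChartAt 𝓘(ℝ, E) x x)) (ν.inChart x (extChartAt 𝓘(ℝ, E) x x))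
        (fderiv ℝ (μ.inChart x) (extChartAt 𝓘(ℝ, E) x x))
        (fderiv ℝ (ν.inChart x) (extChartAt 𝓘(ℝ, E) x x)) ∘L dChart 𝓘(ℝ, E) x x := by
  have hx := mem_extChartAt_source (I := 𝓘(ℝ, E)) x
  have e1 : ∀ y ∈ (extChartAt 𝓘(ℝ, E) x).target,
      (fun z => Λ z (μ z) (ν z)) ((extChartAt 𝓘(ℝ, E) x).symm y) =
        Λ.inChart x y (μ.inChart x y) (ν.inChart x y) := by
    intro y hy
    have hz := (extChartAt 𝓘(ℝ, E) x).map_target hy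
    have := inChart_tensor_apply Λ hz (μ.inChart x y) (ν.inChart x y)
    rw [(extChartAt 𝓘(ℝ, E) x).right_inv hy] at this
    rw [this]
    have h1 := inChart_form_comp_dChart μ hz
    have h2 := inChart_form_comp_dChart ν hz
    rw [(extChartAt 𝓘(ℝ, E) x).right_inv hy] at h1 h2
    rw [h1, h2]
  have e2 := hasFDerivAt_tensor_apply (hΛ.differentiableAt x).hasFDerivAt
    (hμ.differentiableAt x).hasFDerivAt (hν.differentiableAt x).hasFDerivAt
  have e3 := e2.congr_of_eventuallyEq
    (Filter.eventuallyEq_of_mem (extChartAt_target_mem_nhds (I := 𝓘(ℝ, E)) x) e1)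
  have e4 : ∀ (μ ν : Form1 𝓘(ℝ, E) M), ν.extDeriv x (Λ.sharp x (μ x)) =
      ((fderiv ℝ (ν.inChart x) (extChartAt 𝓘(ℝ, E) x x) -
        (fderiv ℝ (ν.inChart x) (extChartAt 𝓘(ℝ, E) x x)).flip)
        ((Λ.inChart x (extChartAt 𝓘(ℝ, E) x x)).sharp
          (μ.inChart x (extChartAt 𝓘(ℝ, E) x x)))) ∘L dChart 𝓘(ℝ, E) x x := by
    intro μ ν
    rw [← inChart_sharp, BundleMap.inChart_apply _ hx, inChart_form_comp_dChart μ hx,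
      ← fderivWithin_univ]
    have : Set.range (𝓘(ℝ, E) : E → E) = Set.univ := by simp
    rw [← this]
    rfl
  rw [TensorField2.formBracket, e4, e4, mvfderiv_eq_fderiv_comp hx e3.differentiableAt, e3.fderiv]
  rfl

omit [FiniteDimensional ℝ E] in
theorem dChart_mlieBracket {F : BundleMap 𝓘(ℝ, E) M} {x : M}
    {G : E →L[ℝ] (E →L[ℝ] ℝ) →L[ℝ] E}
    (hF : HasFDerivAt (F.inChart x) G (extChartAt 𝓘(ℝ, E) x x))
    {μ ν : Form1 𝓘(ℝ, E) M} (hμ : μ.Smooth) (hν : ν.Smooth) :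
    dChart 𝓘(ℝ, E) x x (VectorField.mlieBracket 𝓘(ℝ, E) (fun y => F y (μ y)) (fun y => F y (ν y)) x)
      = (G (F.inChart x (extChartAt 𝓘(ℝ, E) x x) (μ.inChart x (extChartAt 𝓘(ℝ, E) x x)))
          (ν.inChart x (extChartAt 𝓘(ℝ, E) x x)) +
        F.inChart x (extChartAt 𝓘(ℝ, E) x x) (fderiv ℝ (ν.inChart x) (extChartAt 𝓘(ℝ, E) x x)
          (F.inChart x (extChartAt 𝓘(ℝ, E) x x) (μ.inChart x (extChartAt 𝓘(ℝ, E) x x))))) -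
        (G (F.inChart x (extChartAt 𝓘(ℝ, E) x x) (ν.inChart x (extChartAt 𝓘(ℝ, E) x x)))
          (μ.inChart x (extChartAt 𝓘(ℝ, E) x x)) +
        F.inChart x (extChartAt 𝓘(ℝ, E) x x) (fderiv ℝ (μ.inChart x) (extChartAt 𝓘(ℝ, E) x x)
          (F.inChart x (extChartAt 𝓘(ℝ, E) x x) (ν.inChart x (extChartAt 𝓘(ℝ, E) x x))))) := by
  have hx := mem_extChartAt_source (I := 𝓘(ℝ, E)) x
  -- `V μ` is the vector field F(μ) transported to the chart, the form in which `mlieBracket` is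
  -- defined. Near the centre it is the product of the coordinate expressions, so the product rule
  -- gives its derivative.
  obtain ⟨V, hV⟩ : ∃ V : Form1 𝓘(ℝ, E) M → E → E, V = fun μ =>
      VectorField.mpullbackWithin 𝓘(ℝ, E) 𝓘(ℝ, E) (extChartAt 𝓘(ℝ, E) x).symm
        (fun y => F y (μ y)) (Set.range 𝓘(ℝ, E)) := ⟨_, rfl⟩
  have e1 : ∀ μ : Form1 𝓘(ℝ, E) M,
      V μ =ᶠ[𝓝 (extChartAt 𝓘(ℝ, E) x x)] fun y => F.inChart x y (μ.inChart x y) := by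
    intro μ
    filter_upwards [extChartAt_target_mem_nhds x] with y hy
    have hz := (extChartAt 𝓘(ℝ, E) x).map_target hy
    have h1 := inChart_form_comp_dChart μ hz
    have h2 := F.inChart_apply hz (μ.inChart x y)
    rw [(extChartAt 𝓘(ℝ, E) x).right_inv hy] at h1 h2
    rw [h2, h1, hV]
    have h3 := ContinuousLinearMap.inverse_eq
        (mfderivWithin_extChartAt_symm_comp_mfderiv_extChartAt hy)
        (mfderiv_extChartAt_comp_mfderivWithin_extChartAt_symm hy)
    exact DFunLike.congr_fun h3 _
  have e3 : ∀ μ : Form1 𝓘(ℝ, E) M, μ.Smooth →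
      fderiv ℝ (V μ) (extChartAt 𝓘(ℝ, E) x x) =
        F.inChart x (extChartAt 𝓘(ℝ, E) x x) ∘L
          fderiv ℝ (μ.inChart x) (extChartAt 𝓘(ℝ, E) x x) +
        G.flip (μ.inChart x (extChartAt 𝓘(ℝ, E) x x)) :=
    fun μ hμ => ((hF.clm_apply (hμ.differentiableAt x).hasFDerivAt).congr_of_eventuallyEq
      (e1 μ)).fderiv
  have e4 : dChart 𝓘(ℝ, E) x x
      (VectorField.mlieBracket 𝓘(ℝ, E) (fun y => F y (μ y)) (fun y => F y (ν y)) x) =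
      VectorField.lieBracketWithin ℝ (V μ) (V ν)
        ((extChartAt 𝓘(ℝ, E) x).symm ⁻¹' Set.univ ∩ Set.range 𝓘(ℝ, E))
        (extChartAt 𝓘(ℝ, E) x x) := by
    rw [← VectorField.mlieBracketWithin_univ, VectorField.mlieBracketWithin_apply, hV]
    obtain ⟨e, he⟩ := isInvertible_mfderiv_extChartAt (I := 𝓘(ℝ, E)) hx
    rw [← he, ContinuousLinearMap.inverse_equiv]
    have h5 : ∀ v, dChart 𝓘(ℝ, E) x x v = e v := fun v => (DFunLike.congr_fun he v).symm
    exact (h5 _).trans (e.apply_symm_apply _)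
  have hu : (extChartAt 𝓘(ℝ, E) x).symm ⁻¹' Set.univ ∩ Set.range (𝓘(ℝ, E) : E → E) = Set.univ := by
    simp
  rw [e4, hu, VectorField.lieBracketWithin_univ, VectorField.lieBracket_eq]
  simp only [e3 μ hμ, e3 ν hν, (e1 μ).eq_of_nhds, (e1 ν).eq_of_nhds]
  simp [add_comm]

end Charts

/-! ### Brackets of one-forms and of functions in charts -/

section Brackets

variable {E : Type*} [NormedAddCommGroup E] [NormedSpace ℝ E]
  {M : Type*} [TopologicalSpace M] [ChartedSpace E M] [IsManifold 𝓘(ℝ, E) ∞ M]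

theorem contDiffOn_comp_extChartAt_symm {V : Type*} [NormedAddCommGroup V] [NormedSpace ℝ V]
    {f : M → V} (hf : ContMDiff 𝓘(ℝ, E) 𝓘(ℝ, V) ∞ f) (p : M) :
    ContDiffOn ℝ ∞ (fun y => f ((extChartAt 𝓘(ℝ, E) p).symm y)) (extChartAt 𝓘(ℝ, E) p).target :=
  (hf.comp_contMDiffOn (contMDiffOn_extChartAt_symm p)).contDiffOn

theorem mvfderiv_extChartAt_symm {V : Type*} [NormedAddCommGroup V] [NormedSpace ℝ V]
    {f : M → V} {p : M} {y : E} (hy : y ∈ (extChartAt 𝓘(ℝ, E) p).target)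
    (hf : DifferentiableAt ℝ (fun y => f ((extChartAt 𝓘(ℝ, E) p).symm y)) y) :
    mvfderiv 𝓘(ℝ, E) f ((extChartAt 𝓘(ℝ, E) p).symm y) =
      fderiv ℝ (fun y => f ((extChartAt 𝓘(ℝ, E) p).symm y)) y ∘L
        dChart 𝓘(ℝ, E) p ((extChartAt 𝓘(ℝ, E) p).symm y) := by
  have h := mvfderiv_eq_fderiv_comp (f := f) ((extChartAt 𝓘(ℝ, E) p).map_target hy)
  rw [(extChartAt 𝓘(ℝ, E) p).right_inv hy] at h
  exact h hf

/-- The bracket of functions in a chart. -/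
theorem bracket_extChartAt_symm (Λ : TensorField2 𝓘(ℝ, E) M) {f g : M → ℝ} {p : M} {y : E}
    (hy : y ∈ (extChartAt 𝓘(ℝ, E) p).target)
    (hf : DifferentiableAt ℝ (fun y => f ((extChartAt 𝓘(ℝ, E) p).symm y)) y)
    (hg : DifferentiableAt ℝ (fun y => g ((extChartAt 𝓘(ℝ, E) p).symm y)) y) :
    Λ.bracket f g ((extChartAt 𝓘(ℝ, E) p).symm y) =
      Λ.inChart p y (fderiv ℝ (fun y => f ((extChartAt 𝓘(ℝ, E) p).symm y)) y)
        (fderiv ℝ (fun y => g ((extChartAt 𝓘(ℝ, E) p).symm y)) y) := by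
  rw [TensorField2.bracket, mvfderiv_extChartAt_symm hy hf, mvfderiv_extChartAt_symm hy hg]
  rfl

variable [FiniteDimensional ℝ E]

/-- Expanding the iterated brackets yields Hessian terms and derivatives of Λ. The Hessians cancel,
and the cyclic sum is left. -/
theorem jacobi_iff_jacobiModel {Λ : TensorField2 𝓘(ℝ, E) M} (hΛ : Λ.Smooth) (hs : Λ.Skew)
    {f g h : M → ℝ} (hf : ContMDiff 𝓘(ℝ, E) 𝓘(ℝ) ∞ f) (hg : ContMDiff 𝓘(ℝ, E) 𝓘(ℝ) ∞ g)
    (hh : ContMDiff 𝓘(ℝ, E) 𝓘(ℝ) ∞ h) (x : M) {L : Tensor2 E} {D : E →L[ℝ] Tensor2 E}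
    {a b c : E →L[ℝ] ℝ}
    (hL : Λ.inChart x (extChartAt 𝓘(ℝ, E) x x) = L)
    (hD : fderiv ℝ (Λ.inChart x) (extChartAt 𝓘(ℝ, E) x x) = D)
    (ha : fderiv ℝ (fun y => f ((extChartAt 𝓘(ℝ, E) x).symm y)) (extChartAt 𝓘(ℝ, E) x x) = a)
    (hb : fderiv ℝ (fun y => g ((extChartAt 𝓘(ℝ, E) x).symm y)) (extChartAt 𝓘(ℝ, E) x x) = b)
    (hc : fderiv ℝ (fun y => h ((extChartAt 𝓘(ℝ, E) x).symm y)) (extChartAt 𝓘(ℝ, E) x x) = c) :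
    Λ.bracket (Λ.bracket f g) h x =
        Λ.bracket f (Λ.bracket g h) x - Λ.bracket g (Λ.bracket f h) x ↔
      D (L.sharp a) b c + D (L.sharp b) c a + D (L.sharp c) a b = 0 := by
  have hx := mem_extChartAt_source (I := 𝓘(ℝ, E)) x
  have ht := mem_extChartAt_target (I := 𝓘(ℝ, E)) x
  have hn := extChartAt_target_mem_nhds (I := 𝓘(ℝ, E)) x
  have hLs : ∀ α β, L α β = -L β α := by
    rw [← hL]
    exact (skew_iff_inChart hx).1 (hs x)
  have hDs : ∀ u α β, D u α β = -D u β α := by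
    rw [← hD]
    exact fderiv_skew hΛ hs x
  have d1 : ∀ f : M → ℝ, ContMDiff 𝓘(ℝ, E) 𝓘(ℝ) ∞ f → ∀ y ∈ (extChartAt 𝓘(ℝ, E) x).target,
      ContDiffAt ℝ ∞ (fun y => f ((extChartAt 𝓘(ℝ, E) x).symm y)) y := fun f hf y hy =>
    (contDiffOn_comp_extChartAt_symm hf x).contDiffAt (extChartAt_target_mem_nhds_of_mem hy)
  have d2 : ∀ f : M → ℝ, ContMDiff 𝓘(ℝ, E) 𝓘(ℝ) ∞ f →
      ∃ A : E →L[ℝ] E →L[ℝ] ℝ, (∀ u v, A u v = A v u) ∧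
        HasFDerivAt (fderiv ℝ (fun y => f ((extChartAt 𝓘(ℝ, E) x).symm y))) A
          (extChartAt 𝓘(ℝ, E) x x) := by
    intro f hf
    have hd := d1 f hf _ ht
    have hd' : ContDiffAt ℝ 1 (fderiv ℝ (fun y => f ((extChartAt 𝓘(ℝ, E) x).symm y)))
        (extChartAt 𝓘(ℝ, E) x x) :=
      hd.fderiv_right (WithTop.coe_le_coe.2 (le_top : (1 + 1 : ℕ∞) ≤ ⊤))
    refine ⟨_, ?_, (hd'.differentiableAt (by simp)).hasFDerivAt⟩
    exact fun u v => (hd.isSymmSndFDerivAt (by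
      simpa using WithTop.coe_le_coe.2 (le_top : (2 : ℕ∞) ≤ ⊤))).eq u v
  have d3 : ∀ (f g : M → ℝ) (A B : E →L[ℝ] E →L[ℝ] ℝ), ContMDiff 𝓘(ℝ, E) 𝓘(ℝ) ∞ f →
      ContMDiff 𝓘(ℝ, E) 𝓘(ℝ) ∞ g →
      HasFDerivAt (fderiv ℝ (fun y => f ((extChartAt 𝓘(ℝ, E) x).symm y))) A
          (extChartAt 𝓘(ℝ, E) x x) →
      HasFDerivAt (fderiv ℝ (fun y => g ((extChartAt 𝓘(ℝ, E) x).symm y))) B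
          (extChartAt 𝓘(ℝ, E) x x) →
      HasFDerivAt (fun y => Λ.bracket f g ((extChartAt 𝓘(ℝ, E) x).symm y)) _
        (extChartAt 𝓘(ℝ, E) x x) := fun f g A B hf hg hA hB =>
    (hasFDerivAt_tensor_apply (hΛ.differentiableAt x).hasFDerivAt hA hB).congr_of_eventuallyEq
      (eventuallyEq_of_mem hn fun y hy => bracket_extChartAt_symm Λ hy
        ((d1 f hf y hy).differentiableAt (by simp)) ((d1 g hg y hy).differentiableAt (by simp)))
  have d4 : ∀ f g : M → ℝ,
      DifferentiableAt ℝ (fun y => f ((extChartAt 𝓘(ℝ, E) x).symm y)) (extChartAt 𝓘(ℝ, E) x x) →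
      DifferentiableAt ℝ (fun y => g ((extChartAt 𝓘(ℝ, E) x).symm y)) (extChartAt 𝓘(ℝ, E) x x) →
      Λ.bracket f g x = L (fderiv ℝ (fun y => f ((extChartAt 𝓘(ℝ, E) x).symm y))
          (extChartAt 𝓘(ℝ, E) x x))
        (fderiv ℝ (fun y => g ((extChartAt 𝓘(ℝ, E) x).symm y)) (extChartAt 𝓘(ℝ, E) x x)) := by
    intro f g hf hg
    have := bracket_extChartAt_symm Λ ht hf hg
    rwa [extChartAt_to_inv, hL] at this
  obtain ⟨A, hA, hfA⟩ := d2 f hf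
  obtain ⟨B, hB, hgB⟩ := d2 g hg
  obtain ⟨C, hC, hhC⟩ := d2 h hh
  have fg := d3 f g A B hf hg hfA hgB
  have gh := d3 g h B C hg hh hgB hhC
  have fh := d3 f h A C hf hh hfA hhC
  have f1 := (d1 f hf _ ht).differentiableAt (by simp)
  have g1 := (d1 g hg _ ht).differentiableAt (by simp)
  have h1 := (d1 h hh _ ht).differentiableAt (by simp)
  rw [d4 _ _ fg.differentiableAt h1, d4 _ _ f1 gh.differentiableAt, d4 _ _ g1 fh.differentiableAt,
    fg.fderiv, gh.fderiv, fh.fderiv, ha, hb, hc, hL, hD, hLs _ c]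
  have e : ∀ (p q r : E →L[ℝ] ℝ) (P Q : E →L[ℝ] E →L[ℝ] ℝ),
      L r (L.flip q ∘L P + L p ∘L Q + (D.flip p).flip q) =
        -P (L.sharp r) (L.sharp q) + Q (L.sharp r) (L.sharp p) + D (L.sharp r) p q := by
    intro p q r P Q
    rw [← L.apply_sharp]
    simp [hLs _ q, ← L.apply_sharp p, ← L.apply_sharp q]
  -- Each Hessian occurs twice, with its arguments exchanged; its symmetry aligns the two
  -- occurrences for cancellation.
  rw [e, e, e, hA (L.sharp c), hB (L.sharp c), hC (L.sharp a), hDs _ c a]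
  constructor <;> intro H <;> linarith

theorem map_formBracket_eq_mlieBracket_iff {F : BundleMap 𝓘(ℝ, E) M} {Λ : TensorField2 𝓘(ℝ, E) M}
    (hΛ : Λ.Smooth) {x : M} {G : E →L[ℝ] (E →L[ℝ] ℝ) →L[ℝ] E}
    (hF : HasFDerivAt (F.inChart x) G (extChartAt 𝓘(ℝ, E) x x))
    {μ ν : Form1 𝓘(ℝ, E) M} (hμ : μ.Smooth) (hν : ν.Smooth) {m n : E →L[ℝ] ℝ}
    {A B : E →L[ℝ] E →L[ℝ] ℝ}
    (hm : μ.inChart x (extChartAt 𝓘(ℝ, E) x x) = m) (hn : ν.inChart x (extChartAt 𝓘(ℝ, E) x x) = n)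
    (hA : fderiv ℝ (μ.inChart x) (extChartAt 𝓘(ℝ, E) x x) = A)
    (hB : fderiv ℝ (ν.inChart x) (extChartAt 𝓘(ℝ, E) x x) = B) :
    F x (Λ.formBracket μ ν x) =
        VectorField.mlieBracket 𝓘(ℝ, E) (fun y => F y (μ y)) (fun y => F y (ν y)) x ↔
      F.inChart x (extChartAt 𝓘(ℝ, E) x x)
          (bracketModel (Λ.inChart x (extChartAt 𝓘(ℝ, E) x x))
            (fderiv ℝ (Λ.inChart x) (extChartAt 𝓘(ℝ, E) x x)) m n A B) =
        (G (F.inChart x (extChartAt 𝓘(ℝ, E) x x) m) n +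
          F.inChart x (extChartAt 𝓘(ℝ, E) x x) (B (F.inChart x (extChartAt 𝓘(ℝ, E) x x) m))) -
        (G (F.inChart x (extChartAt 𝓘(ℝ, E) x x) n) m +
          F.inChart x (extChartAt 𝓘(ℝ, E) x x) (A (F.inChart x (extChartAt 𝓘(ℝ, E) x x) n))) := by
  have hx := mem_extChartAt_source (I := 𝓘(ℝ, E)) x
  rw [← (dChart_injective hx).eq_iff, dChart_mlieBracket hF hμ hν, formBracket_eq hΛ hμ hν,
    ← F.inChart_apply hx, hm, hn, hA, hB]

variable [T2Space M]

/-- Each chart agrees, near its centre, with a smooth map defined on the whole manifold. -/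
theorem exists_contMDiff_eventuallyEq_extChartAt (x : M) :
    ∃ G : M → E, ContMDiff 𝓘(ℝ, E) 𝓘(ℝ, E) ∞ G ∧
      (fun y => G ((extChartAt 𝓘(ℝ, E) x).symm y)) =ᶠ[𝓝 (extChartAt 𝓘(ℝ, E) x x)] id := by
  obtain ⟨χ⟩ : Nonempty (SmoothBumpFunction 𝓘(ℝ, E) x) := inferInstance
  -- The chart is cut off by a bump function equal to 1 near x; the product with the cutoff is
  -- smooth on all of M because M is Hausdorff.
  refine ⟨fun z => χ z • extChartAt 𝓘(ℝ, E) x z, χ.contMDiff_smul contMDiffOn_extChartAt, ?_⟩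
  have h1 : ∀ᶠ y in 𝓝 (extChartAt 𝓘(ℝ, E) x x), χ ((extChartAt 𝓘(ℝ, E) x).symm y) = 1 := by
    have hc := continuousAt_extChartAt_symm (I := 𝓘(ℝ, E)) x
    rw [ContinuousAt, extChartAt_to_inv] at hc
    exact hc.eventually χ.eventuallyEq_one
  filter_upwards [h1, extChartAt_target_mem_nhds x] with y hy hy'
  rw [hy, one_smul, (extChartAt 𝓘(ℝ, E) x).right_inv hy', id]

theorem exists_contMDiff_fderiv_eq (x : M) (a : E →L[ℝ] ℝ) :
    ∃ f : M → ℝ, ContMDiff 𝓘(ℝ, E) 𝓘(ℝ) ∞ f ∧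
      fderiv ℝ (fun y => f ((extChartAt 𝓘(ℝ, E) x).symm y)) (extChartAt 𝓘(ℝ, E) x x) = a := by
  obtain ⟨G, hG, hGx⟩ := exists_contMDiff_eventuallyEq_extChartAt (E := E) x
  refine ⟨a ∘ G, a.contMDiff.comp hG, ?_⟩
  have h : (fun y => (a ∘ G) ((extChartAt 𝓘(ℝ, E) x).symm y)) =ᶠ[𝓝 (extChartAt 𝓘(ℝ, E) x x)] a := by
    filter_upwards [hGx] with y hy
    exact congrArg a hy
  rw [h.fderiv_eq, a.fderiv]

/-- There are smooth one-forms with any given value and derivative at a point. -/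
theorem exists_form_jet_eq (x : M) (m : E →L[ℝ] ℝ) (A : E →L[ℝ] E →L[ℝ] ℝ) :
    ∃ μ : Form1 𝓘(ℝ, E) M, μ.Smooth ∧ μ.inChart x (extChartAt 𝓘(ℝ, E) x x) = m ∧
      fderiv ℝ (μ.inChart x) (extChartAt 𝓘(ℝ, E) x x) = A := by
  obtain ⟨G, hG, hGx⟩ := exists_contMDiff_eventuallyEq_extChartAt (E := E) x
  -- This is the pull-back under `G` of the affine one-form y ↦ m + A(y - x₀) on E, with x₀ the
  -- image of x. It is globally smooth, and near x it is exactly that affine form in the chart.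
  obtain ⟨μ, hμ⟩ : ∃ μ : Form1 𝓘(ℝ, E) M, μ = fun z =>
      (m + A (G z - extChartAt 𝓘(ℝ, E) x x)) ∘L mvfderiv 𝓘(ℝ, E) G z := ⟨_, rfl⟩
  have e1 : ∀ p : M, ∀ y ∈ (extChartAt 𝓘(ℝ, E) p).target, μ.inChart p y =
      (m + A (G ((extChartAt 𝓘(ℝ, E) p).symm y) - extChartAt 𝓘(ℝ, E) x x)) ∘L
        fderiv ℝ (fun y => G ((extChartAt 𝓘(ℝ, E) p).symm y)) y := by
    intro p y hy
    have hd := ((contDiffOn_comp_extChartAt_symm hG p).contDiffAt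
      (extChartAt_target_mem_nhds_of_mem hy)).differentiableAt (by simp)
    ext v
    have h1 := DFunLike.congr_fun (mvfderiv_extChartAt_symm hy hd) (dChartSymm 𝓘(ℝ, E) p y v)
    have h2 := h1.trans (congrArg
      (fderiv ℝ (fun y => G ((extChartAt 𝓘(ℝ, E) p).symm y)) y) (dChart_dChartSymm hy v))
    simp only [hμ]
    exact congrArg (m + A (G ((extChartAt 𝓘(ℝ, E) p).symm y) - extChartAt 𝓘(ℝ, E) x x)) h2
  have e2 : μ.inChart x =ᶠ[𝓝 (extChartAt 𝓘(ℝ, E) x x)]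
      fun y => m + A (y - extChartAt 𝓘(ℝ, E) x x) := by
    filter_upwards [hGx, hGx.fderiv (𝕜 := ℝ), extChartAt_target_mem_nhds x] with y h1 h2 h3
    rw [e1 x y h3, h2]
    simp only [id] at h1
    rw [h1, fderiv_id]
    rfl
  refine ⟨μ, fun p => ?_, ?_, ?_⟩
  · have hc := contDiffOn_comp_extChartAt_symm hG p
    refine ContDiffOn.congr ?_ (e1 p)
    refine ContDiffOn.clm_comp ?_ ?_
    · exact contDiffOn_const.add (A.contDiff.comp_contDiffOn (hc.sub contDiffOn_const))
    · exact hc.fderiv_of_isOpen (isOpen_extChartAt_target p) (by simp)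
  · rw [e2.eq_of_nhds]
    simp
  · rw [e2.fderiv_eq]
    have : HasFDerivAt (fun y => m + A (y - extChartAt 𝓘(ℝ, E) x x)) A
        (extChartAt 𝓘(ℝ, E) x x) := by
      have h := A.hasFDerivAt.comp (extChartAt 𝓘(ℝ, E) x x)
        ((hasFDerivAt_id (extChartAt 𝓘(ℝ, E) x x)).sub_const (extChartAt 𝓘(ℝ, E) x x))
      exact (h.const_add m).congr_fderiv (by ext; simp)
    exact this.fderiv

theorem bracketHomAt_iff {F : BundleMap 𝓘(ℝ, E) M} {Λ : TensorField2 𝓘(ℝ, E) M}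
    (hΛ : Λ.Smooth) {x : M} {G : E →L[ℝ] (E →L[ℝ] ℝ) →L[ℝ] E}
    (hF : HasFDerivAt (F.inChart x) G (extChartAt 𝓘(ℝ, E) x x)) :
    (∀ μ ν : Form1 𝓘(ℝ, E) M, μ.Smooth → ν.Smooth → F x (Λ.formBracket μ ν x) =
        VectorField.mlieBracket 𝓘(ℝ, E) (fun y => F y (μ y)) (fun y => F y (ν y)) x) ↔
      HomModel (F.inChart x (extChartAt 𝓘(ℝ, E) x x)) G (Λ.inChart x (extChartAt 𝓘(ℝ, E) x x))
        (fderiv ℝ (Λ.inChart x) (extChartAt 𝓘(ℝ, E) x x)) := by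
  constructor
  · intro h m n A B
    obtain ⟨μ, hμ, hm, hA⟩ := exists_form_jet_eq x m A
    obtain ⟨ν, hν, hn, hB⟩ := exists_form_jet_eq x n B
    exact (map_formBracket_eq_mlieBracket_iff hΛ hF hμ hν hm hn hA hB).1 (h μ ν hμ hν)
  · intro h μ ν hμ hν
    exact (map_formBracket_eq_mlieBracket_iff hΛ hF hμ hν rfl rfl rfl rfl).2 (h _ _ _ _)

theorem isPoisson_iff {Λ : TensorField2 𝓘(ℝ, E) M} (hΛ : Λ.Smooth) :
    Λ.IsPoisson ↔ Λ.Skew ∧ ∀ x, JacobiModel (Λ.inChart x (extChartAt 𝓘(ℝ, E) x x))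
      (fderiv ℝ (Λ.inChart x) (extChartAt 𝓘(ℝ, E) x x)) := by
  refine and_congr_right fun hs => ⟨fun h x a b c => ?_, fun h f g k hf hg hk x => ?_⟩
  · obtain ⟨f, hf, ha⟩ := exists_contMDiff_fderiv_eq x a
    obtain ⟨g, hg, hb⟩ := exists_contMDiff_fderiv_eq x b
    obtain ⟨k, hk, hc⟩ := exists_contMDiff_fderiv_eq x c
    exact (jacobi_iff_jacobiModel hΛ hs hf hg hk x rfl rfl ha hb hc).1 (h f g k hf hg hk x)
  · exact (jacobi_iff_jacobiModel hΛ hs hf hg hk x rfl rfl rfl rfl rfl).2 (h x _ _ _)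

end Brackets

/-! ### Charts of the tangent and cotangent bundles -/

section Bundles

variable {E : Type*} [NormedAddCommGroup E] [NormedSpace ℝ E]
  {M : Type*} [TopologicalSpace M] [ChartedSpace E M] [IsManifold 𝓘(ℝ, E) ∞ M]

theorem trivializationAt_tangent_snd {p : M} {w : TangentBundle 𝓘(ℝ, E) M}
    (h : w.proj ∈ (extChartAt 𝓘(ℝ, E) p).source) :
    (trivializationAt E (TangentSpace 𝓘(ℝ, E)) p w).2 = dChart 𝓘(ℝ, E) p w.proj w.snd := by
  have h' : w.proj ∈ (chartAt E p).source := by simpa using h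
  refine Eq.trans ?_ (DFunLike.congr_fun
    (TangentBundle.continuousLinearMapAt_trivializationAt (I := 𝓘(ℝ, E)) h') w.snd)
  rw [Bundle.Trivialization.continuousLinearMapAt_apply,
    Bundle.Trivialization.coe_linearMapAt_of_mem _ h']

theorem extChartAt_tangent_apply {v w : TangentBundle 𝓘(ℝ, E) M}
    (h : w.proj ∈ (extChartAt 𝓘(ℝ, E) v.proj).source) :
    extChartAt (𝓘(ℝ, E)).tangent v w =
      (extChartAt 𝓘(ℝ, E) v.proj w.proj, dChart 𝓘(ℝ, E) v.proj w.proj w.snd) := by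
  rw [FiberBundle.extChartAt]
  exact Prod.ext rfl (trivializationAt_tangent_snd h)

theorem extChartAt_cotangent_symm_apply (ξ : CotangentBundle 𝓘(ℝ, E) M) {y : E} (p : E →L[ℝ] ℝ)
    (hy : y ∈ (extChartAt 𝓘(ℝ, E) ξ.proj).target) :
    (extChartAt (cotangentModel 𝓘(ℝ, E)) ξ).symm (y, p) =
      ⟨(extChartAt 𝓘(ℝ, E) ξ.proj).symm y, p ∘L dChart 𝓘(ℝ, E) ξ.proj _⟩ := by
  rw [FiberBundle.extChartAt]
  refine (Bundle.Pretrivialization.continuousLinearMap_symm_apply (RingHom.id ℝ)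
    (trivializationAt E (TangentSpace 𝓘(ℝ, E)) ξ.proj)
    (trivializationAt ℝ (Bundle.Trivial M ℝ) ξ.proj)
    ((extChartAt 𝓘(ℝ, E) ξ.proj).symm y, p)).trans (congrArg _ ?_)
  have hC := TangentBundle.continuousLinearMapAt_trivializationAt (I := 𝓘(ℝ, E)) (x₀ := ξ.proj)
    (x := (extChartAt 𝓘(ℝ, E) ξ.proj).symm y)
    (by simpa using (extChartAt 𝓘(ℝ, E) ξ.proj).map_target hy)
  have hT := Bundle.Trivial.symmL_trivialization (𝕜 := ℝ) (B := M) (F := ℝ)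
    ((extChartAt 𝓘(ℝ, E) ξ.proj).symm y)
  ext v
  exact (DFunLike.congr_fun hT _).trans (congrArg p (DFunLike.congr_fun hC v))

/-- The trivialization of T*M sends a covector to its composite with the inverse of the chart
derivative. Composing with `dChart` removes the inverse. -/
theorem trivializationAt_cotangent_snd {p : M} {η : CotangentBundle 𝓘(ℝ, E) M}
    (h : η.proj ∈ (extChartAt 𝓘(ℝ, E) p).source) :
    (trivializationAt (E →L[ℝ] ℝ) (fun x : M => TangentSpace 𝓘(ℝ, E) x →L[ℝ] ℝ) p η).2 ∘L
      dChart 𝓘(ℝ, E) p η.proj = η.snd := by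
  have h' : η.proj ∈ (chartAt E p).source := by simpa using h
  have hC := TangentBundle.symmL_trivializationAt (I := 𝓘(ℝ, E)) (x₀ := p) (x := η.proj) h'
  have hS := mfderivWithin_extChartAt_symm_comp_mfderiv_extChartAt' (I := 𝓘(ℝ, E)) h
  have hT := Bundle.Trivial.continuousLinearMapAt_trivialization (𝕜 := ℝ) (B := M) (F := ℝ) η.proj
  ext v
  exact (DFunLike.congr_fun hT _).trans (congrArg η.snd ((DFunLike.congr_fun hC _).trans
    (DFunLike.congr_fun hS v)))

theorem extChartAt_cotangent_fst (ξ : CotangentBundle 𝓘(ℝ, E) M) :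
    (extChartAt (cotangentModel 𝓘(ℝ, E)) ξ ξ).1 = extChartAt 𝓘(ℝ, E) ξ.proj ξ.proj := by
  rw [FiberBundle.extChartAt]
  rfl

theorem extChartAt_cotangent_snd (ξ : CotangentBundle 𝓘(ℝ, E) M) :
    (extChartAt (cotangentModel 𝓘(ℝ, E)) ξ ξ).2 ∘L dChart 𝓘(ℝ, E) ξ.proj ξ.proj = ξ.snd := by
  rw [FiberBundle.extChartAt]
  exact trivializationAt_cotangent_snd (mem_extChartAt_source _)

/-- The tangent space at a point is the model space, identified through the preferred chart at that
same point, so this chart has identity derivative there. The lifts thereby reduce to their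
coordinate models. -/
theorem coordBasis_tangent (v : TangentBundle 𝓘(ℝ, E) M) :
    coordBasis (𝓘(ℝ, E)).tangent v = ContinuousLinearMap.id ℝ (E × E) := by
  have h : dChart (𝓘(ℝ, E)).tangent v v = ContinuousLinearMap.id ℝ (E × E) :=
    mfderiv_extChartAt_self (I := (𝓘(ℝ, E)).tangent) (x := v)
  exact (congrArg ContinuousLinearMap.inverse h).trans ContinuousLinearMap.inverse_id

theorem coordBasis_cotangent (ξ : CotangentBundle 𝓘(ℝ, E) M) :
    coordBasis (cotangentModel 𝓘(ℝ, E)) ξ = ContinuousLinearMap.id ℝ (E × (E →L[ℝ] ℝ)) := by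
  have h : dChart (cotangentModel 𝓘(ℝ, E)) ξ ξ = ContinuousLinearMap.id ℝ (E × (E →L[ℝ] ℝ)) :=
    mfderiv_extChartAt_self (I := cotangentModel 𝓘(ℝ, E)) (x := ξ)
  exact (congrArg ContinuousLinearMap.inverse h).trans ContinuousLinearMap.inverse_id

theorem canonicalPoisson_eq (ξ : CotangentBundle 𝓘(ℝ, E) M) :
    canonicalPoisson 𝓘(ℝ, E) M ξ = canonicalModel E := by
  exact congrArg (fun A : E × (E →L[ℝ] ℝ) →L[ℝ] E × (E →L[ℝ] ℝ) =>
    Tensor2.map A A (canonicalModel E)) (coordBasis_cotangent ξ)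

theorem completeLift_eq (Λ : TensorField2 𝓘(ℝ, E) M) {x : M} (v : TangentSpace 𝓘(ℝ, E) x) :
    Λ.completeLift ⟨x, v⟩ = liftModel (Λ.inChart x (extChartAt 𝓘(ℝ, E) x x))
      (fderiv ℝ (Λ.inChart x) (extChartAt 𝓘(ℝ, E) x x)) (dChart 𝓘(ℝ, E) x x v) := by
  have h1 := coordBasis_tangent (⟨x, v⟩ : TangentBundle 𝓘(ℝ, E) M)
  have h2 := extChartAt_tangent_apply (v := (⟨x, v⟩ : TangentBundle 𝓘(ℝ, E) M)) (w := ⟨x, v⟩)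
    (mem_extChartAt_source x)
  have hu : Set.range (𝓘(ℝ, E) : E → E) = Set.univ := by simp
  have h3 : completeLiftModel (Λ.inChart x) (Set.range 𝓘(ℝ, E))
      (extChartAt (𝓘(ℝ, E)).tangent (⟨x, v⟩ : TangentBundle 𝓘(ℝ, E) M) ⟨x, v⟩).1
      (extChartAt (𝓘(ℝ, E)).tangent (⟨x, v⟩ : TangentBundle 𝓘(ℝ, E) M) ⟨x, v⟩).2 =
      liftModel (Λ.inChart x (extChartAt 𝓘(ℝ, E) x x))
        (fderiv ℝ (Λ.inChart x) (extChartAt 𝓘(ℝ, E) x x)) (dChart 𝓘(ℝ, E) x x v) := by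
    rw [h2, completeLiftModel, hu, fderivWithin_univ]
    rfl
  exact (congrArg (fun A : E × E →L[ℝ] E × E => Tensor2.map A A (completeLiftModel (Λ.inChart x)
    (Set.range 𝓘(ℝ, E))
      (extChartAt (𝓘(ℝ, E)).tangent (⟨x, v⟩ : TangentBundle 𝓘(ℝ, E) M) ⟨x, v⟩).1
      (extChartAt (𝓘(ℝ, E)).tangent (⟨x, v⟩ : TangentBundle 𝓘(ℝ, E) M) ⟨x, v⟩).2)) h1).trans h3

/-- A bundle morphism in the charts of the cotangent and tangent bundles. -/
theorem writtenInExtChartAt_total (F : BundleMap 𝓘(ℝ, E) M) (ξ : CotangentBundle 𝓘(ℝ, E) M) :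
    writtenInExtChartAt (cotangentModel 𝓘(ℝ, E)) (𝓘(ℝ, E)).tangent ξ F.total
      =ᶠ[𝓝 (extChartAt (cotangentModel 𝓘(ℝ, E)) ξ ξ)] fun q => (q.1, F.inChart ξ.proj q.1 q.2) := by
  have hn : ∀ᶠ q : E × (E →L[ℝ] ℝ) in 𝓝 (extChartAt (cotangentModel 𝓘(ℝ, E)) ξ ξ),
      q.1 ∈ (extChartAt 𝓘(ℝ, E) ξ.proj).target := by
    refine continuousAt_fst.eventually ?_
    rw [extChartAt_cotangent_fst]
    exact extChartAt_target_mem_nhds _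
  filter_upwards [hn] with q hq
  rw [writtenInExtChartAt, Function.comp_apply, Function.comp_apply,
    extChartAt_cotangent_symm_apply ξ q.2 hq]
  refine (extChartAt_tangent_apply (v := F.total ξ)
    (w := F.total ⟨(extChartAt 𝓘(ℝ, E) ξ.proj).symm q.1, q.2 ∘L dChart 𝓘(ℝ, E) ξ.proj _⟩)
    ((extChartAt 𝓘(ℝ, E) ξ.proj).map_target hq)).trans ?_
  exact Prod.ext ((extChartAt 𝓘(ℝ, E) ξ.proj).right_inv hq) rfl

variable [FiniteDimensional ℝ E]

omit [FiniteDimensional ℝ E] in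
theorem mdifferentiableAt_total {F : BundleMap 𝓘(ℝ, E) M}
    (hF : F.Smooth) (ξ : CotangentBundle 𝓘(ℝ, E) M) :
    MDifferentiableAt (cotangentModel 𝓘(ℝ, E)) (𝓘(ℝ, E)).tangent F.total ξ :=
  (hF ξ).mdifferentiableAt (by simp)

omit [FiniteDimensional ℝ E] in
theorem range_cotangentModel : Set.range (cotangentModel 𝓘(ℝ, E)) = Set.univ := by
  simp

theorem differentiableAt_clm_of_apply {V W U : Type*} [NormedAddCommGroup V] [NormedSpace ℝ V]
    [NormedAddCommGroup W] [NormedSpace ℝ W] [NormedAddCommGroup U] [NormedSpace ℝ U]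
    [FiniteDimensional ℝ V] {f : U → V →L[ℝ] W} {u : U}
    (h : ∀ v, DifferentiableAt ℝ (fun y => f y v) u) : DifferentiableAt ℝ f u := by
  let d := Module.finrank ℝ V
  have hd : d = Module.finrank ℝ (Fin d → ℝ) := (Module.finrank_fin_fun ℝ).symm
  let e₁ := ContinuousLinearEquiv.ofFinrankEq hd
  let e₂ := (e₁.arrowCongr (1 : W ≃L[ℝ] W)).trans (ContinuousLinearEquiv.piRing (Fin d))
  rw [← Function.id_comp f, ← e₂.symm_comp_self]
  exact e₂.symm.differentiableAt.comp u (differentiableAt_pi.2 fun i => h _)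

/-- Smoothness of the map of total spaces gives differentiability of y ↦ F_y p for each fixed p.
Finite dimension of the dual upgrades this to the operator-valued map. -/
theorem BundleMap.Smooth.differentiableAt {F : BundleMap 𝓘(ℝ, E) M} (hF : F.Smooth) (x : M) :
    DifferentiableAt ℝ (F.inChart x) (extChartAt 𝓘(ℝ, E) x x) := by
  refine differentiableAt_clm_of_apply fun p => ?_
  -- The covector at x whose fibre coordinate is p.
  obtain ⟨ξ, hξ⟩ : ∃ ξ : CotangentBundle 𝓘(ℝ, E) M, ξ = ⟨x, p ∘L dChart 𝓘(ℝ, E) x x⟩ := ⟨_, rfl⟩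
  have hq : extChartAt (cotangentModel 𝓘(ℝ, E)) ξ ξ = (extChartAt 𝓘(ℝ, E) x x, p) := by
    refine Prod.ext ?_ ?_
    · rw [extChartAt_cotangent_fst, hξ]
    · have := extChartAt_cotangent_snd ξ
      subst hξ
      exact comp_dChart_injective (mem_extChartAt_source x) this
  have h1 := (mdifferentiableAt_total hF ξ).differentiableWithinAt_writtenInExtChartAt
  rw [range_cotangentModel, differentiableWithinAt_univ,
    (writtenInExtChartAt_total F ξ).differentiableAt_iff, hq] at h1
  have h2 : DifferentiableAt ℝ (fun y : E => (y, p)) (extChartAt 𝓘(ℝ, E) x x) := by fun_prop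
  have h3 := (h1.comp (extChartAt 𝓘(ℝ, E) x x) h2).snd
  subst hξ
  exact h3

omit [FiniteDimensional ℝ E] in
theorem mfderiv_total {F : BundleMap 𝓘(ℝ, E) M} (hF : F.Smooth) (ξ : CotangentBundle 𝓘(ℝ, E) M)
    {G : E →L[ℝ] (E →L[ℝ] ℝ) →L[ℝ] E}
    (hG : HasFDerivAt (F.inChart ξ.proj) G (extChartAt 𝓘(ℝ, E) ξ.proj ξ.proj)) :
    mfderiv (cotangentModel 𝓘(ℝ, E)) (𝓘(ℝ, E)).tangent F.total ξ =
      morphismDeriv (F.inChart ξ.proj (extChartAt 𝓘(ℝ, E) ξ.proj ξ.proj)) G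
        (extChartAt (cotangentModel 𝓘(ℝ, E)) ξ ξ).2 := by
  have h1 := (mdifferentiableAt_total hF ξ).mfderiv
  rw [range_cotangentModel, fderivWithin_univ, (writtenInExtChartAt_total F ξ).fderiv_eq] at h1
  refine h1.trans ?_
  rw [← extChartAt_cotangent_fst] at hG ⊢
  obtain ⟨q, hq⟩ : ∃ q, extChartAt (cotangentModel 𝓘(ℝ, E)) ξ ξ = q := ⟨_, rfl⟩
  rw [hq] at hG ⊢
  have h2 : HasFDerivAt (fun q : E × (E →L[ℝ] ℝ) => (q.1, F.inChart ξ.proj q.1 q.2)) _ q :=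
    hasFDerivAt_fst.prodMk ((hG.comp q hasFDerivAt_fst).clm_apply hasFDerivAt_snd)
  refine h2.fderiv.trans ?_
  ext <;> simp [morphismDeriv]

/-- In the trivializations at a base point, the map is a smooth operator-valued function of the base
applied to the fibre coordinate. -/
theorem smooth_sharp {Λ : TensorField2 𝓘(ℝ, E) M} (hΛ : Λ.Smooth) :
    BundleMap.Smooth Λ.sharp := by
  intro ξ
  have hn : ∀ᶠ η : CotangentBundle 𝓘(ℝ, E) M in 𝓝 ξ,
      η.proj ∈ (extChartAt 𝓘(ℝ, E) ξ.proj).source :=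
    (FiberBundle.continuous_proj (E →L[ℝ] ℝ)
      (fun x : M => TangentSpace 𝓘(ℝ, E) x →L[ℝ] ℝ)).continuousAt.eventually
        (extChartAt_source_mem_nhds ξ.proj)
  have hp : ContMDiffAt (cotangentModel 𝓘(ℝ, E)) 𝓘(ℝ, E) ∞
      (fun η : CotangentBundle 𝓘(ℝ, E) M => η.proj) ξ :=
    Bundle.contMDiffAt_proj _
  have hq : ContMDiffAt (cotangentModel 𝓘(ℝ, E)) 𝓘(ℝ, E →L[ℝ] ℝ) ∞
      (fun η : CotangentBundle 𝓘(ℝ, E) M => (trivializationAt (E →L[ℝ] ℝ)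
        (fun x : M => TangentSpace 𝓘(ℝ, E) x →L[ℝ] ℝ) ξ.proj η).2) ξ :=
    (Bundle.contMDiffAt_totalSpace.1 (contMDiffAt_id (x := ξ))).2
  refine Bundle.contMDiffAt_totalSpace.2 ⟨hp, ?_⟩
  have hS : ContDiffAt ℝ ∞ (BundleMap.inChart Λ.sharp ξ.proj)
      (extChartAt 𝓘(ℝ, E) ξ.proj ξ.proj) := by
    have : BundleMap.inChart Λ.sharp ξ.proj = Tensor2.sharpL E ∘ Λ.inChart ξ.proj :=
      funext fun y => inChart_sharp Λ ξ.proj y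
    rw [this]
    exact (Tensor2.sharpL E).contDiff.contDiffAt.comp _
      ((hΛ ξ.proj).contDiffAt (extChartAt_target_mem_nhds ξ.proj))
  have hφ : ContMDiffAt (cotangentModel 𝓘(ℝ, E)) 𝓘(ℝ, E) ∞
      (fun η : CotangentBundle 𝓘(ℝ, E) M => extChartAt 𝓘(ℝ, E) ξ.proj η.proj) ξ :=
    (contMDiffAt_extChartAt (x := ξ.proj)).comp ξ hp
  have hSφ : ContMDiffAt (cotangentModel 𝓘(ℝ, E)) 𝓘(ℝ, (E →L[ℝ] ℝ) →L[ℝ] E) ∞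
      (fun η : CotangentBundle 𝓘(ℝ, E) M =>
        BundleMap.inChart Λ.sharp ξ.proj (extChartAt 𝓘(ℝ, E) ξ.proj η.proj)) ξ :=
    hS.contMDiffAt.comp ξ hφ
  refine (hSφ.clm_apply hq).congr_of_eventuallyEq ?_
  filter_upwards [hn] with η hη
  rw [BundleMap.inChart_apply _ hη, trivializationAt_cotangent_snd hη]
  exact trivializationAt_tangent_snd (p := ξ.proj) (w := BundleMap.total Λ.sharp η) hη

omit [FiniteDimensional ℝ E] in
-- The covectors at x are exactly the p ∘ `dChart`, so relatedness over x is the model condition for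
-- all p. The scalar `c` treats Λ^c and -Λ^c together.
theorem related_iff_relatedModel {F : BundleMap 𝓘(ℝ, E) M} (hF : F.Smooth)
    (Λ : TensorField2 𝓘(ℝ, E) M) {G : M → E →L[ℝ] (E →L[ℝ] ℝ) →L[ℝ] E}
    (hG : ∀ x, HasFDerivAt (F.inChart x) (G x) (extChartAt 𝓘(ℝ, E) x x)) (c : ℝ) :
    Related F.total (canonicalPoisson 𝓘(ℝ, E) M) (c • Λ.completeLift) ↔
      ∀ x, RelatedModel (F.inChart x (extChartAt 𝓘(ℝ, E) x x)) (G x)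
        (c • Λ.inChart x (extChartAt 𝓘(ℝ, E) x x))
        (c • fderiv ℝ (Λ.inChart x) (extChartAt 𝓘(ℝ, E) x x)) := by
  have key : ∀ (x : M) (p : E →L[ℝ] ℝ),
      Tensor2.map (mfderiv (cotangentModel 𝓘(ℝ, E)) (𝓘(ℝ, E)).tangent F.total
          ⟨x, p ∘L dChart 𝓘(ℝ, E) x x⟩)
        (mfderiv (cotangentModel 𝓘(ℝ, E)) (𝓘(ℝ, E)).tangent F.total ⟨x, p ∘L dChart 𝓘(ℝ, E) x x⟩)
        (canonicalPoisson 𝓘(ℝ, E) M ⟨x, p ∘L dChart 𝓘(ℝ, E) x x⟩) =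
          c • Λ.completeLift (F.total ⟨x, p ∘L dChart 𝓘(ℝ, E) x x⟩) ↔
      (canonicalModel E).map
        (morphismDeriv (F.inChart x (extChartAt 𝓘(ℝ, E) x x)) (G x) p)
        (morphismDeriv (F.inChart x (extChartAt 𝓘(ℝ, E) x x)) (G x) p) =
      liftModel (c • Λ.inChart x (extChartAt 𝓘(ℝ, E) x x))
        (c • fderiv ℝ (Λ.inChart x) (extChartAt 𝓘(ℝ, E) x x))
        (F.inChart x (extChartAt 𝓘(ℝ, E) x x) p) := by
    intro x p
    have hx := mem_extChartAt_source (I := 𝓘(ℝ, E)) x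
    have h1 := mfderiv_total hF ⟨x, p ∘L dChart 𝓘(ℝ, E) x x⟩ (hG x)
    have h2 := canonicalPoisson_eq (⟨x, p ∘L dChart 𝓘(ℝ, E) x x⟩ : CotangentBundle 𝓘(ℝ, E) M)
    have h3 := completeLift_eq Λ (F x (p ∘L dChart 𝓘(ℝ, E) x x))
    have hp : (extChartAt (cotangentModel 𝓘(ℝ, E))
        (⟨x, p ∘L dChart 𝓘(ℝ, E) x x⟩ : CotangentBundle 𝓘(ℝ, E) M)
        ⟨x, p ∘L dChart 𝓘(ℝ, E) x x⟩).2 = p :=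
      comp_dChart_injective hx (extChartAt_cotangent_snd _)
    rw [← F.inChart_apply hx] at h3
    rw [hp] at h1
    have h4 : ∀ w, liftModel (c • Λ.inChart x (extChartAt 𝓘(ℝ, E) x x))
        (c • fderiv ℝ (Λ.inChart x) (extChartAt 𝓘(ℝ, E) x x)) w =
        c • liftModel (Λ.inChart x (extChartAt 𝓘(ℝ, E) x x))
        (fderiv ℝ (Λ.inChart x) (extChartAt 𝓘(ℝ, E) x x)) w := by
      intro w
      refine ContinuousLinearMap.ext fun α => ContinuousLinearMap.ext fun β => ?_
      have e : ∀ r s t : ℝ, c * r + c * s + c * t = c * (r + s + t) := fun r s t => by ring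
      exact e (fderiv ℝ (Λ.inChart x) (extChartAt 𝓘(ℝ, E) x x) w
          (α ∘L ContinuousLinearMap.inr ℝ E E) (β ∘L ContinuousLinearMap.inr ℝ E E))
        (Λ.inChart x (extChartAt 𝓘(ℝ, E) x x)
          (α ∘L ContinuousLinearMap.inl ℝ E E) (β ∘L ContinuousLinearMap.inr ℝ E E))
        (Λ.inChart x (extChartAt 𝓘(ℝ, E) x x)
          (α ∘L ContinuousLinearMap.inr ℝ E E) (β ∘L ContinuousLinearMap.inl ℝ E E))
    rw [h4]
    have h5 := congrArg₂ (fun (A : E × (E →L[ℝ] ℝ) →L[ℝ] E × E) (P : Tensor2 (E × (E →L[ℝ] ℝ))) =>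
      Tensor2.map A A P) h1 h2
    exact ⟨fun h => h5.symm.trans (h.trans (congrArg (fun P : Tensor2 (E × E) => c • P) h3)),
      fun h => h5.trans (h.trans (congrArg (fun P : Tensor2 (E × E) => c • P) h3).symm)⟩
  constructor
  · intro h x p
    exact (key x p).1 (h _)
  · rintro h ⟨x, α⟩
    obtain ⟨p, rfl⟩ := exists_comp_dChart_eq (mem_extChartAt_source (I := 𝓘(ℝ, E)) x) α
    exact (key x p).2 (h x p)

end Bundles

/-! ### Rigidity and the characterizations -/

section Main

variable {E : Type*} [NormedAddCommGroup E] [NormedSpace ℝ E] [FiniteDimensional ℝ E]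
  {M : Type*} [TopologicalSpace M] [ChartedSpace E M] [IsManifold 𝓘(ℝ, E) ∞ M]

omit [FiniteDimensional ℝ E] in
theorem related_iff {F : BundleMap 𝓘(ℝ, E) M} (hF : F.Smooth)
    (Λ : TensorField2 𝓘(ℝ, E) M) {G : M → E →L[ℝ] (E →L[ℝ] ℝ) →L[ℝ] E}
    (hG : ∀ x, HasFDerivAt (F.inChart x) (G x) (extChartAt 𝓘(ℝ, E) x x)) :
    Related F.total (canonicalPoisson 𝓘(ℝ, E) M) Λ.completeLift ↔
      ∀ x, RelatedModel (F.inChart x (extChartAt 𝓘(ℝ, E) x x)) (G x)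
        (Λ.inChart x (extChartAt 𝓘(ℝ, E) x x))
        (fderiv ℝ (Λ.inChart x) (extChartAt 𝓘(ℝ, E) x x)) := by
  have h := related_iff_relatedModel hF Λ hG 1
  have e : (1 : ℝ) • Λ.completeLift = Λ.completeLift := funext fun v => one_smul ℝ _
  simpa only [e, one_smul] using h

omit [FiniteDimensional ℝ E] in
theorem related_neg_iff {F : BundleMap 𝓘(ℝ, E) M} (hF : F.Smooth)
    (Λ : TensorField2 𝓘(ℝ, E) M) {G : M → E →L[ℝ] (E →L[ℝ] ℝ) →L[ℝ] E}
    (hG : ∀ x, HasFDerivAt (F.inChart x) (G x) (extChartAt 𝓘(ℝ, E) x x)) :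
    Related F.total (canonicalPoisson 𝓘(ℝ, E) M) (-Λ.completeLift) ↔
      ∀ x, RelatedModel (F.inChart x (extChartAt 𝓘(ℝ, E) x x)) (G x)
        (-Λ.inChart x (extChartAt 𝓘(ℝ, E) x x))
        (-fderiv ℝ (Λ.inChart x) (extChartAt 𝓘(ℝ, E) x x)) := by
  have h := related_iff_relatedModel hF Λ hG (-1)
  have e : (-1 : ℝ) • Λ.completeLift = -Λ.completeLift := funext fun v =>
    ContinuousLinearMap.ext fun α => ContinuousLinearMap.ext fun β =>
      neg_one_mul (Λ.completeLift v α β)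
  have e₁ : ∀ P : Tensor2 E, (-1 : ℝ) • P = -P := fun P =>
    ContinuousLinearMap.ext fun α => ContinuousLinearMap.ext fun β => neg_one_mul (P α β)
  have e₂ : ∀ D : E →L[ℝ] Tensor2 E, (-1 : ℝ) • D = -D := fun D =>
    ContinuousLinearMap.ext fun u => e₁ (D u)
  simpa only [e, e₁, e₂] using h

theorem related_neg_completeLift_iff {Λ : TensorField2 𝓘(ℝ, E) M} (hΛ : Λ.Smooth) :
    Related (BundleMap.total Λ.sharp) (canonicalPoisson 𝓘(ℝ, E) M)
        (TensorField2.completeLift (-Λ)) ↔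
      Related (BundleMap.total Λ.sharp) (canonicalPoisson 𝓘(ℝ, E) M) (-Λ.completeLift) := by
  rw [related_iff (smooth_sharp hΛ) (-Λ) (hasFDerivAt_sharp hΛ),
    related_neg_iff (smooth_sharp hΛ) Λ (hasFDerivAt_sharp hΛ)]
  refine forall_congr' fun x => ?_
  rw [inChart_neg, fderiv_neg]
  rfl

theorem eq_sharp_of_related {Λ : TensorField2 𝓘(ℝ, E) M} {F : BundleMap 𝓘(ℝ, E) M}
    (hF : F.Smooth)
    (h : Related F.total (canonicalPoisson 𝓘(ℝ, E) M) (-Λ.completeLift)) :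
    Λ.Skew ∧ F = Λ.sharp := by
  rw [related_neg_iff hF Λ fun x => (hF.differentiableAt x).hasFDerivAt] at h
  refine ⟨fun x => ?_, funext fun x => ?_⟩
  · refine (skew_iff_inChart (mem_extChartAt_source x)).2 fun a b => ?_
    have := (h x).eq_of_neg.2 a b
    simpa using congrArg Neg.neg this
  · refine BundleMap.eq_of_inChart_eq (mem_extChartAt_source x) ?_
    rw [inChart_sharp, (h x).eq_of_neg.1, neg_neg]

theorem eq_neg_of_related {Λ Λ₁ : TensorField2 𝓘(ℝ, E) M} (hΛ : Λ.Smooth)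
    (h : Related (BundleMap.total Λ.sharp) (canonicalPoisson 𝓘(ℝ, E) M) Λ₁.completeLift) :
    Λ.Skew ∧ Λ₁ = -Λ := by
  rw [related_iff (smooth_sharp hΛ) Λ₁ (hasFDerivAt_sharp hΛ)] at h
  have key : ∀ x, Λ.inChart x (extChartAt 𝓘(ℝ, E) x x) =
      -Λ₁.inChart x (extChartAt 𝓘(ℝ, E) x x) := fun x =>
    Tensor2.sharp_injective ((inChart_sharp Λ x _).symm.trans (h x).eq_of_neg.1)
  refine ⟨fun x => ?_, funext fun x => ?_⟩
  · refine (skew_iff_inChart (mem_extChartAt_source x)).2 fun a b => ?_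
    rw [key]
    exact congrArg Neg.neg ((h x).eq_of_neg.2 a b)
  · refine tensor_eq_of_inChart_eq (mem_extChartAt_source x) ?_
    rw [inChart_neg, Pi.neg_apply, key, neg_neg]

/-- The algebraic equivalence needs skewness: the Poisson side contains it, and on the related side
rigidity provides it. -/
theorem isPoisson_iff_related [T2Space M] {Λ : TensorField2 𝓘(ℝ, E) M} (hΛ : Λ.Smooth) :
    Λ.IsPoisson ↔
      Related (BundleMap.total Λ.sharp) (canonicalPoisson 𝓘(ℝ, E) M) (-Λ.completeLift) := by
  have key : Λ.Skew → ((∀ x, JacobiModel (Λ.inChart x (extChartAt 𝓘(ℝ, E) x x))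
      (fderiv ℝ (Λ.inChart x) (extChartAt 𝓘(ℝ, E) x x))) ↔
      Related (BundleMap.total Λ.sharp) (canonicalPoisson 𝓘(ℝ, E) M) (-Λ.completeLift)) := by
    intro hs
    rw [related_neg_iff (smooth_sharp hΛ) Λ (hasFDerivAt_sharp hΛ)]
    refine forall_congr' fun x => ?_
    rw [inChart_sharp]
    exact (relatedModel_sharp_iff (fun u α β => Tensor2.apply_sharp _ α β)
      ((skew_iff_inChart (mem_extChartAt_source x)).1 (hs x)) (fderiv_skew hΛ hs x)).symm
  rw [isPoisson_iff hΛ]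
  refine ⟨fun h => (key h.1).1 h.2, fun h => ?_⟩
  have hs := (eq_sharp_of_related (smooth_sharp hΛ) h).1
  exact ⟨hs, (key hs).2 h⟩

omit [FiniteDimensional ℝ E] in
-- Both morphisms are compared in the single chart at x, where the difference of their expressions
-- is continuous and nonzero at the centre.
theorem BundleMap.eventually_ne {F G : BundleMap 𝓘(ℝ, E) M} {x : M}
    (hF : DifferentiableAt ℝ (F.inChart x) (extChartAt 𝓘(ℝ, E) x x))
    (hG : DifferentiableAt ℝ (G.inChart x) (extChartAt 𝓘(ℝ, E) x x)) (h : F x ≠ G x) :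
    ∀ᶠ z in 𝓝 x, F z ≠ G z := by
  have hx := mem_extChartAt_source (I := 𝓘(ℝ, E)) x
  have h1 : F.inChart x (extChartAt 𝓘(ℝ, E) x x) ≠ G.inChart x (extChartAt 𝓘(ℝ, E) x x) :=
    fun H => h (BundleMap.eq_of_inChart_eq hx H)
  have h2 := (continuousAt_extChartAt (I := 𝓘(ℝ, E)) x).eventually
    ((hF.sub hG).continuousAt.eventually_ne (sub_ne_zero.2 h1))
  filter_upwards [h2, extChartAt_source_mem_nhds (I := 𝓘(ℝ, E)) x] with z hz hz' H
  refine hz (sub_eq_zero.2 (ContinuousLinearMap.ext fun a => ?_))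
  rw [F.inChart_apply hz', G.inChart_apply hz', H]

omit [FiniteDimensional ℝ E] [IsManifold 𝓘(ℝ, E) ∞ M] in
theorem BundleMap.inChart_zero (p : M) (y : E) :
    BundleMap.inChart (0 : BundleMap 𝓘(ℝ, E) M) p y = 0 := by
  ext a
  exact map_zero (dChart 𝓘(ℝ, E) p _)

omit [IsManifold 𝓘(ℝ, E) ∞ M] in
theorem tensor_eq_of_sharp_eq {P Q : TensorField2 𝓘(ℝ, E) M} {x : M}
    (h : P.sharp x = Q.sharp x) : P x = Q x := by
  ext α β
  rw [← (P x).apply_sharp, ← (Q x).apply_sharp]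
  exact congrArg β (DFunLike.congr_fun h α)

omit [FiniteDimensional ℝ E] [IsManifold 𝓘(ℝ, E) ∞ M] in
theorem BundleMap.differentiableAt_inChart_zero (p : M) (y : E) :
    DifferentiableAt ℝ (BundleMap.inChart (0 : BundleMap 𝓘(ℝ, E) M) p) y := by
  rw [show BundleMap.inChart (0 : BundleMap 𝓘(ℝ, E) M) p = fun _ => 0 from
    funext (BundleMap.inChart_zero p)]
  exact differentiableAt_const _

omit [IsManifold 𝓘(ℝ, E) ∞ M] in
theorem eq_zero_of_sharp_eq_zero {Λ : TensorField2 𝓘(ℝ, E) M} {x : M} (h : Λ.sharp x = 0) :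
    Λ x = 0 := by
  ext α β
  rw [← (Λ x).apply_sharp]
  exact (congrArg β (DFunLike.congr_fun h α)).trans (map_zero β)

theorem sharp_eq_zero {Λ : TensorField2 𝓘(ℝ, E) M} {x : M} (h : Λ x = 0) : Λ.sharp x = 0 := by
  have hx := mem_extChartAt_source (I := 𝓘(ℝ, E)) x
  refine BundleMap.eq_of_inChart_eq (G := 0) hx ?_
  have : Λ.inChart x (extChartAt 𝓘(ℝ, E) x x) = 0 := by
    ext a b
    rw [inChart_tensor_apply Λ hx, h]
    rfl
  rw [inChart_sharp, this, BundleMap.inChart_zero, ← Tensor2.sharpL_apply, map_zero]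

variable [T2Space M]

theorem BundleMap.IsBracketHom.eq_zero_or {F : BundleMap 𝓘(ℝ, E) M} {Λ : TensorField2 𝓘(ℝ, E) M}
    (hΛ : Λ.Smooth) {x : M} (hF : DifferentiableAt ℝ (F.inChart x) (extChartAt 𝓘(ℝ, E) x x))
    (h : F.IsBracketHom Λ) :
    F x = 0 ∨ (F x = Λ.sharp x ∧ ∀ α β, Λ x α β = -Λ x β α) := by
  have hx := mem_extChartAt_source (I := 𝓘(ℝ, E)) x
  have hm := (bracketHomAt_iff hΛ hF.hasFDerivAt).1 fun μ ν hμ hν => h μ ν hμ hν x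
  refine hm.eq_zero_or.imp (fun h0 => ?_) fun h1 => ⟨?_, (skew_iff_inChart hx).2 h1.2⟩
  · exact BundleMap.eq_of_inChart_eq (G := 0) hx (h0.trans (BundleMap.inChart_zero _ _).symm)
  · exact BundleMap.eq_of_inChart_eq hx (h1.1.trans (inChart_sharp Λ x _).symm)

theorem eq_sharp_of_isBracketHom {F : BundleMap 𝓘(ℝ, E) M} {Λ : TensorField2 𝓘(ℝ, E) M}
    (hΛ : Λ.Smooth) (hF : F.Smooth) (hs : F.SupportContains Λ) (h : F.IsBracketHom Λ) :
    Λ.Skew ∧ F = Λ.sharp := by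
  have h0 : ∀ x, F x = 0 ∨ (F x = Λ.sharp x ∧ ∀ α β, Λ x α β = -Λ x β α) := fun x =>
    h.eq_zero_or hΛ (hF.differentiableAt x)
  have h1 : ∀ x, F x = Λ.sharp x := by
    intro x
    by_contra hx
    -- F ≠ ♯ persists near x, and there the pointwise alternative leaves only F = 0; the support
    -- hypothesis then makes ♯ vanish as well.
    have h2 : ∀ᶠ z in 𝓝 x, F z = 0 := by
      filter_upwards [BundleMap.eventually_ne (hF.differentiableAt x)
        (hasFDerivAt_sharp hΛ x).differentiableAt hx] with z hz
      exact (h0 z).resolve_right fun H => hz H.1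
    obtain ⟨U, hU, hUo, hxU⟩ := eventually_nhds_iff.1 h2
    have h3 := sharp_eq_zero (hs U hUo hU x hxU)
    exact hx ((hU x hxU).trans h3.symm)
  refine ⟨fun x => ?_, funext h1⟩
  rcases h0 x with H | H
  · have h4 := eq_zero_of_sharp_eq_zero ((h1 x).symm.trans H)
    intro α β
    rw [h4]
    simp
  · exact H.2

omit [T2Space M] [IsManifold 𝓘(ℝ, E) ∞ M] in
theorem supportContains_sharp (Λ : TensorField2 𝓘(ℝ, E) M) :
    BundleMap.SupportContains Λ.sharp Λ := fun _ _ hU x hx => eq_zero_of_sharp_eq_zero (hU x hx)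

theorem isPoisson_iff_isBracketHom {Λ : TensorField2 𝓘(ℝ, E) M} (hΛ : Λ.Smooth) :
    Λ.IsPoisson ↔ BundleMap.IsBracketHom Λ.sharp Λ := by
  have key : Λ.Skew → ((∀ x, JacobiModel (Λ.inChart x (extChartAt 𝓘(ℝ, E) x x))
      (fderiv ℝ (Λ.inChart x) (extChartAt 𝓘(ℝ, E) x x))) ↔
      BundleMap.IsBracketHom Λ.sharp Λ) := by
    intro hs
    have e : ∀ x, HomModel (Λ.inChart x (extChartAt 𝓘(ℝ, E) x x)).sharp
      (Tensor2.sharpL E ∘L fderiv ℝ (Λ.inChart x) (extChartAt 𝓘(ℝ, E) x x))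
      (Λ.inChart x (extChartAt 𝓘(ℝ, E) x x))
      (fderiv ℝ (Λ.inChart x) (extChartAt 𝓘(ℝ, E) x x)) ↔
      JacobiModel (Λ.inChart x (extChartAt 𝓘(ℝ, E) x x))
        (fderiv ℝ (Λ.inChart x) (extChartAt 𝓘(ℝ, E) x x)) := fun x =>
      homModel_sharp_iff (fun u α β => Tensor2.apply_sharp _ α β)
        ((skew_iff_inChart (mem_extChartAt_source x)).1 (hs x)) (fderiv_skew hΛ hs x)
    have e' := fun x => bracketHomAt_iff hΛ (hasFDerivAt_sharp hΛ x)
    simp only [inChart_sharp] at e'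
    exact ⟨fun h μ ν hμ hν x => (e' x).2 ((e x).2 (h x)) μ ν hμ hν,
      fun h x => (e x).1 ((e' x).1 fun μ ν hμ hν => h μ ν hμ hν x)⟩
  rw [isPoisson_iff hΛ]
  refine ⟨fun h => (key h.1).1 h.2, fun h => ?_⟩
  have hs : Λ.Skew := (eq_sharp_of_isBracketHom hΛ (smooth_sharp hΛ) (supportContains_sharp Λ) h).1
  exact ⟨hs, (key hs).2 h⟩

/-- The brackets of Λ and Λ₁ need only agree after applying ♯_Λ. That is trivial where ♯_Λ = 0;
elsewhere the rigidity alternative for ♯_Λ and Λ₁ identifies the two tensors. -/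
theorem isBracketHom_sharp_of_isBracketHom {Λ Λ₁ : TensorField2 𝓘(ℝ, E) M} (hΛ : Λ.Smooth)
    (hΛ₁ : Λ₁.Smooth) (h : BundleMap.IsBracketHom Λ.sharp Λ₁) :
    BundleMap.IsBracketHom Λ.sharp Λ := by
  intro μ ν hμ hν x
  rw [← h μ ν hμ hν x]
  by_cases h0 : Λ.sharp x = 0
  · rw [h0]
    rfl
  -- Equality on a neighbourhood is needed, since the bracket of forms differentiates the tensor.
  have h1 : ∀ᶠ z in 𝓝 x, Λ z = Λ₁ z := by
    filter_upwards [BundleMap.eventually_ne (G := 0) (hasFDerivAt_sharp hΛ x).differentiableAt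
      (BundleMap.differentiableAt_inChart_zero x _) h0] with z hz
    have := (h.eq_zero_or hΛ₁ (hasFDerivAt_sharp hΛ z).differentiableAt).resolve_left hz
    exact tensor_eq_of_sharp_eq this.1
  have h2 : Λ.sharp x = Λ₁.sharp x := by
    rw [TensorField2.sharp, TensorField2.sharp, h1.self_of_nhds]
  have h3 : (fun y => Λ y (μ y) (ν y)) =ᶠ[𝓝 x] fun y => Λ₁ y (μ y) (ν y) := by
    filter_upwards [h1] with z hz
    rw [hz]
  have h4 : Λ.formBracket μ ν x = Λ₁.formBracket μ ν x := by
    rw [TensorField2.formBracket, TensorField2.formBracket, h2]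
    exact congrArg _ h3.mfderiv_eq
  rw [h4]

end Main

end PoissonChar

end

end

open PoissonChar in
theorem mainTheorem1
    {E : Type*} [NormedAddCommGroup E] [NormedSpace ℝ E] [FiniteDimensional ℝ E]
    {M : Type*} [TopologicalSpace M] [T2Space M] [ChartedSpace E M]
    [IsManifold 𝓘(ℝ, E) ∞ M]
    (Λ : TensorField2 𝓘(ℝ, E) M) (hΛ : Λ.Smooth) :
    List.TFAE [
      -- (i)
      Λ.IsPoisson,
      -- (ii)
      BundleMap.IsBracketHom Λ.sharp Λ,
      -- (iii)
      Related (BundleMap.total Λ.sharp) (canonicalPoisson 𝓘(ℝ, E) M) (-Λ.completeLift),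
      -- (iv)
      ∃ F : BundleMap 𝓘(ℝ, E) M, F.Smooth ∧
        Related F.total (canonicalPoisson 𝓘(ℝ, E) M) (-Λ.completeLift),
      -- (v)
      ∃ Λ₁ : TensorField2 𝓘(ℝ, E) M, Λ₁.Smooth ∧
        Related (BundleMap.total Λ.sharp) (canonicalPoisson 𝓘(ℝ, E) M) Λ₁.completeLift,
      -- (vi)
      ∃ F : BundleMap 𝓘(ℝ, E) M, F.Smooth ∧ F.SupportContains Λ ∧ F.IsBracketHom Λ,
      -- (vii)
      ∃ Λ₁ : TensorField2 𝓘(ℝ, E) M, Λ₁.Smooth ∧ BundleMap.IsBracketHom Λ.sharp Λ₁] ∧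
    (∀ F : BundleMap 𝓘(ℝ, E) M, F.Smooth →
      Related F.total (canonicalPoisson 𝓘(ℝ, E) M) (-Λ.completeLift) →
        Λ.Skew ∧ F = Λ.sharp) ∧
    (∀ Λ₁ : TensorField2 𝓘(ℝ, E) M, Λ₁.Smooth →
      Related (BundleMap.total Λ.sharp) (canonicalPoisson 𝓘(ℝ, E) M) Λ₁.completeLift →
        Λ.Skew ∧ Λ₁ = -Λ) ∧
    (∀ F : BundleMap 𝓘(ℝ, E) M, F.Smooth → F.SupportContains Λ → F.IsBracketHom Λ →
      Λ.Skew ∧ F = Λ.sharp) := by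
  have ii := isPoisson_iff_isBracketHom hΛ
  have iii := isPoisson_iff_related hΛ
  refine ⟨?_, fun F hF h => eq_sharp_of_related hF h, fun Λ₁ _ h => eq_neg_of_related hΛ h,
    fun F hF hs h => eq_sharp_of_isBracketHom hΛ hF hs h⟩
  tfae_have 1 ↔ 2 := ii
  tfae_have 1 ↔ 3 := iii
  tfae_have 3 → 4 := fun h => ⟨Λ.sharp, smooth_sharp hΛ, h⟩
  tfae_have 4 → 3
  | ⟨F, hF, h⟩ => by
    rw [← (eq_sharp_of_related hF h).2]
    exact h
  tfae_have 3 → 5 := fun h => ⟨-Λ, hΛ.neg, (related_neg_completeLift_iff hΛ).2 h⟩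
  tfae_have 5 → 3
  | ⟨Λ₁, _, h⟩ => by
    rw [(eq_neg_of_related hΛ h).2] at h
    exact (related_neg_completeLift_iff hΛ).1 h
  tfae_have 2 → 6 := fun h => ⟨Λ.sharp, smooth_sharp hΛ, supportContains_sharp Λ, h⟩
  tfae_have 6 → 2
  | ⟨F, hF, hs, h⟩ => by
    rw [← (eq_sharp_of_isBracketHom hΛ hF hs h).2]
    exact h
  tfae_have 2 → 7 := fun h => ⟨Λ, hΛ, h⟩
  tfae_have 7 → 2
  | ⟨Λ₁, hΛ₁, h⟩ => isBracketHom_sharp_of_isBracketHom hΛ hΛ₁ h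
  tfae_finish
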